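/- **Theorem (Localized order of convergence).** Let $d\ge 1$ and let $\Omega\subset\mathbb R^d$ be a polygonal domain: a connected open set with $\Omega=\operatorname{int}\overline\Omega$ whose closure is a finite union of convex polytopes. Let $V\in C^2(\overline\Omega)$, $\pi=e^{-V}$, and $0<\kappa_*\le\kappa^*$, $M,K\ge 0$. Write $C^2_0(\Omega)$ for the functions in $C^2(\overline\Omega)$ that vanish on $\partial\Omega$. *Meshes.* An admissible mesh $\mathcal T$ of $\Omega$ consists of finitely many pairwise disjoint non-empty open convex polytopes $\Omega_i$ with $\bigcup_i\overline\Omega_i=\overline\Omega$, and distinct nodes $x_i\in\overline\Omega_i$. Write $i\sim j$ if $i\ne j$ and $\sigma_{ij}=\partial\Omega_i\cap\partial\Omega_j$ has positive $(d-1)$-dimensional measure; then $x_j-x_i$ has to be orthogonal to $\sigma_{ij}$. The boundary of every $\Omega_i$ is the union of the interfaces $\sigma_{ij}$, $j\sim i$, and of finitely many boundary interfaces $\sigma$ of positive $(d-1)$-dimensional measure. Each of the latter is the intersection of $\partial\Omega_i\cap\partial\Omega$ with a hyperplane, it does not contain $x_i$, and it contains the foot $y_\sigma$ of the perpendicular from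 $x_i$ to this hyperplane; we also write $\sigma=\sigma_{ij}$, $x_j=y_\sigma$, $j\sim i$. Let $m_{ij}$ be the $(d-1)$-dimensional measure of $\sigma_{ij}$, $h_{ij}=|x_i-x_j|$, $\nu_{ij}=(x_j-x_i)/h_{ij}$ the unit normal, $d_{i,ij}$ the distance of $x_i$ from the hyperplane spanned by $\sigma_{ij}$, and $\sum_{i\sim j}$ the sum over all interfaces, each taken once. For a coefficient $\kappa$ with cell averages $\bar\kappa_i$ put $$\kappa_{ij}=\frac{\bar\kappa_i\bar\kappa_j}{\bar\kappa_i\frac{d_{i,ij}}{h_{ij}}+\bar\kappa_j\frac{d_{j,ij}}{h_{ij}}}$$ on interior interfaces and $\kappa_{ij}=\bar\kappa_i$ on boundary interfaces of $\Omega_i$. For discrete functions $v$ that vanish at the boundary nodes let $$\|v\|_{H_{\mathcal T}}^2=\sum_{i\sim j}\frac{m_{ij}}{h_{ij}}\kappa_{ij}(v_j-v_i)^2 ,$$ and let $(\mathcal R_{\mathcal T}w)_i=w(x_i)$. *Consistency.* Let $\varphi:[0,\infty)\to[0,\infty)$. A family $(\mathcal T_h)_{h\in H}$, $H\subset(0,\infty)$,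 of meshes is $\varphi$-consistent on a set $B\subset C^2_0(\Omega)$ if for every $w\in B$ there is $c(w)\ge 0$ with $$\sum_{i\sim j}\frac{h_{ij}}{m_{ij}}\kappa_{ij}^{-1}\Big|\int_{\sigma_{ij}}\kappa\nabla w\cdot\nu_{ij}-\kappa_{ij}\frac{m_{ij}}{h_{ij}}\big((\mathcal R_{\mathcal T_h}w)_j-(\mathcal R_{\mathcal T_h}w)_i\big)\Big|^2\le c(w)\,\varphi(h)^2\qquad\text{for all }h\in H.$$ *Claim.* There is a constant $C$ that depends only on $\kappa_*,\kappa^*,d,\pi$ (including its domain $\Omega$), $M$ and $K$ such that the following holds. Let $\kappa\in C^1(\overline\Omega)$ with $\kappa_*\le\kappa\le\kappa^*$. Let $S$ be a symmetric mean on $(0,\infty)$ of class $C^2$, that is, $S\in C^2((0,\infty)^2)$, $S(x,y)=S(y,x)$ and $\min(x,y)\le S(x,y)\le\max(x,y)$. Let $(\mathcal T_h)_{h\in H}$ be a family of admissible meshes whose cells satisfy $\operatorname{diam}\Omega_i\le h$ and which is $\varphi$-consistent on $B$ with constants $c(\cdot)$. Let $u\in C^2_0(\Omega)$ solve $$-\nabla\cdot(\kappa\nabla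 u)-\nabla\cdot(\kappa u\nabla V)=f\quad\text{a.e. in }\Omega,$$ with $U:=u/\pi\in B$, $\|U\|_{C^2(\overline\Omega)}\le M$ and $c(U)\le K$. Let $u^{\mathcal T_h}$, with value $0$ at the boundary nodes, solve $$-\sum_{j:\,j\sim i}\frac{m_{ij}}{h_{ij}}\kappa_{ij}\,S(\pi_i,\pi_j)\Big(\frac{u_j^{\mathcal T_h}}{\pi_j}-\frac{u_i^{\mathcal T_h}}{\pi_i}\Big)=\int_{\Omega_i}f\quad\text{for every cell }\Omega_i,\qquad \pi_i=\pi(x_i).$$ Then for every $h\in H$ $$\|u^{\mathcal T_h}-\mathcal R_{\mathcal T_h}u\|_{H_{\mathcal T_h}}^2\le C\,\big(\varphi(h)^2+h^2\big).$$ -/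

import Mathlib

open MeasureTheory

noncomputable section

namespace StolarskyFV

/-- The Euclidean space `ℝ^d`. -/
abbrev Sp (d : ℕ) : Type := EuclideanSpace ℝ (Fin d)

/-- The `(d-1)`-dimensional surface measure on `ℝ^d`, normalised so that it is Lebesgue measure on
hyperplanes. -/
abbrev surf (d : ℕ) : Measure (Sp d) := μHE[d - 1]

/-- A polygonal (polyhedral) domain: a connected open set without slits whose closure is a finite
union of convex polytopes. -/
structure IsPolygonalDomain {d : ℕ} (Ω : Set (Sp d)) : Prop where
  isOpen : IsOpen Ω
  isConnected : IsConnected Ω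
  interior_closure : interior (closure Ω) = Ω
  polytopes : ∃ P : Set (Finset (Sp d)), P.Finite ∧ closure Ω = ⋃ s ∈ P, convexHull ℝ (s : Set (Sp d))

/-- The space `C²_0`: functions that are `C²` up to the boundary and vanish on the boundary. -/
def C20 {d : ℕ} (Ω : Set (Sp d)) : Set (Sp d → ℝ) :=
  {w | ContDiffOn ℝ 2 w (closure Ω) ∧ ∀ x ∈ frontier Ω, w x = 0}

/-- `‖w‖_{C²(closure Ω)} ≤ M`. -/
def C2NormLE {d : ℕ} (Ω : Set (Sp d)) (w : Sp d → ℝ) (M : ℝ) : Prop :=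
  ∀ k : ℕ, k ≤ 2 → ∀ x ∈ closure Ω, ‖iteratedFDerivWithin ℝ k w (closure Ω) x‖ ≤ M

/-- The divergence of a vector field. -/
def divergence {d : ℕ} (F : Sp d → Sp d) (x : Sp d) : ℝ :=
  ∑ k : Fin d, fderiv ℝ F x (EuclideanSpace.single k 1) k

/-- `u` solves `-∇·(κ∇u) - ∇·(κu∇V) = f` in `Ω` (almost everywhere; `f` is a class in `L²`). -/
def SolvesFPE {d : ℕ} (Ω : Set (Sp d)) (κ V f u : Sp d → ℝ) : Prop :=
  ∀ᵐ x ∂(volume.restrict Ω),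
    -divergence (fun z => κ z • gradient u z) x
      - divergence (fun z => (κ z * u z) • gradient V z) x = f x

/-- A symmetric mean on the positive reals, of class `C²`. -/
structure IsSmoothMean (S : ℝ → ℝ → ℝ) : Prop where
  symm : ∀ x y, 0 < x → 0 < y → S x y = S y x
  min_le : ∀ x y, 0 < x → 0 < y → min x y ≤ S x y
  le_max : ∀ x y, 0 < x → 0 < y → S x y ≤ max x y
  smooth : ContDiffOn ℝ 2 (fun p : ℝ × ℝ => S p.1 p.2) (Set.Ioi 0 ×ˢ Set.Ioi 0)

/-- The data of a finite volume mesh: the cells `Ω_i`, the nodes `x_i`, and for every cell the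
boundary nodes `y_σ`. The interfaces are determined by these data, see `face` and `bface`. -/
structure Mesh (d : ℕ) where
  /-- number of cells -/
  N : ℕ
  /-- the control volumes -/
  cell : Fin N → Set (Sp d)
  /-- the nodes of the cells -/
  node : Fin N → Sp d
  /-- the nodes on the boundary interfaces of a cell, one for each of these interfaces -/
  bnode : Fin N → Finset (Sp d)

namespace Mesh

variable {d : ℕ} (T : Mesh d)

/-- `σ_ij = ∂Ω_i ∩ ∂Ω_j`. -/
def face (i j : Fin T.N) : Set (Sp d) := frontier (T.cell i) ∩ frontier (T.cell j)

/-- `i ∼ j` for cells: `σ_ij` is a genuine `(d-1)`-dimensional interface. -/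
def Adj (i j : Fin T.N) : Prop := i ≠ j ∧ 0 < surf d (T.face i j)

/-- The boundary interface `σ` of the cell `i` with `y_σ = y`: the part of `∂Ω_i ∩ ∂Ω` in the
hyperplane through `y` that is orthogonal to `y - x_i`. -/
def bface (Ω : Set (Sp d)) (i : Fin T.N) (y : Sp d) : Set (Sp d) :=
  frontier (T.cell i) ∩ frontier Ω ∩ {p | inner ℝ (p - y) (y - T.node i) = 0}

/-- Admissible finite volume meshes of `Ω`. Cells may touch in sets of dimension less than `d - 1`
without being neighbours. As the cells are open and disjoint, the closures of two of them meet
exactly in `face i j`. -/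
structure IsAdmissible (Ω : Set (Sp d)) : Prop where
  polytope : ∀ i, ∃ s : Finset (Sp d), T.cell i = interior (convexHull ℝ (s : Set (Sp d)))
  nonempty : ∀ i, (T.cell i).Nonempty
  disjoint : ∀ i j, i ≠ j → Disjoint (T.cell i) (T.cell j)
  cover : ⋃ i, closure (T.cell i) = closure Ω
  boundary : ∀ i, frontier (T.cell i) =
    (⋃ j ∈ {j | T.Adj i j}, T.face i j) ∪ ⋃ y ∈ T.bnode i, T.bface Ω i y
  node_mem : ∀ i, T.node i ∈ closure (T.cell i)
  node_injective : Function.Injective T.node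
  orthogonal : ∀ i j, T.Adj i j → ∀ p ∈ T.face i j, ∀ q ∈ T.face i j,
    inner ℝ (T.node j - T.node i) (p - q) = 0
  bnode_mem : ∀ i, ∀ y ∈ T.bnode i, y ∈ T.bface Ω i y
  bnode_pos : ∀ i, ∀ y ∈ T.bnode i, 0 < surf d (T.bface Ω i y)
  node_notMem : ∀ i, ∀ y ∈ T.bnode i, T.node i ∉ T.bface Ω i y

/-- The mean of `κ` over a cell. -/
def kbar (κ : Sp d → ℝ) (i : Fin T.N) : ℝ := ⨍ x in T.cell i, κ x

/-- `d_{i,ij}`: the distance of `x_i` from (the hyperplane spanned by) `σ_ij`. -/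
def dist1 (i j : Fin T.N) : ℝ :=
  Metric.infDist (T.node i) (affineSpan ℝ (T.face i j) : Set (Sp d))

/-- `h_ij`. -/
def hh (i j : Fin T.N) : ℝ := dist (T.node i) (T.node j)

/-- `h_ij` for a boundary node `x_j = y`. -/
def bh (i : Fin T.N) (y : Sp d) : ℝ := dist (T.node i) y

/-- `m_ij`. -/
def m (i j : Fin T.N) : ℝ := (surf d).real (T.face i j)

/-- `m_σ` for a boundary interface. -/
def bm (Ω : Set (Sp d)) (i : Fin T.N) (y : Sp d) : ℝ := (surf d).real (T.bface Ω i y)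

/-- `κ_ij` for neighbouring cells. On a boundary interface of the cell `i` the coefficient is
`kbar κ i`. -/
def kap (κ : Sp d → ℝ) (i j : Fin T.N) : ℝ :=
  T.kbar κ i * T.kbar κ j /
    (T.kbar κ i * (T.dist1 i j / T.hh i j) + T.kbar κ j * (T.dist1 j i / T.hh i j))

/-- `∫_{σ_ij} κ ∇w · ν_ij`. The unit normal of `σ_ij` pointing from cell `i` to cell `j` is
`(x_j - x_i) / h_ij`. -/
def flux (Ω : Set (Sp d)) (κ w : Sp d → ℝ) (i j : Fin T.N) : ℝ :=
  ∫ x in T.face i j,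
    κ x * fderivWithin ℝ w (closure Ω) x ((T.hh i j)⁻¹ • (T.node j - T.node i)) ∂(surf d)

/-- `∫_σ κ ∇w · ν` for a boundary interface; the outer unit normal is `(y - x_i) / |y - x_i|`. -/
def bflux (Ω : Set (Sp d)) (κ w : Sp d → ℝ) (i : Fin T.N) (y : Sp d) : ℝ :=
  ∫ x in T.bface Ω i y,
    κ x * fderivWithin ℝ w (closure Ω) x ((T.bh i y)⁻¹ • (y - T.node i)) ∂(surf d)

open Classical in
/-- The cells adjacent to the cell `i`. -/
def nbrs (i : Fin T.N) : Finset (Fin T.N) := Finset.univ.filter fun j => T.Adj i j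

/-- The sum of an edge function over all interfaces: each interior one once (indexed by `i < j`),
and all boundary ones. -/
def edgeSum (w : Fin T.N → Fin T.N → ℝ) (wb : Fin T.N → Sp d → ℝ) : ℝ :=
  (∑ i, ∑ j ∈ (T.nbrs i).filter (fun j => i < j), w i j) + ∑ i, ∑ y ∈ T.bnode i, wb i y

/-- `‖v‖²_{H_T}` of a discrete function `v` on the cells, extended by zero to the boundary nodes. -/
def normSq (Ω : Set (Sp d)) (κ : Sp d → ℝ) (v : Fin T.N → ℝ) : ℝ :=
  T.edgeSum (fun i j => T.m i j / T.hh i j * T.kap κ i j * (v j - v i) ^ 2)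
    (fun i y => T.bm Ω i y / T.bh i y * T.kbar κ i * (0 - v i) ^ 2)

/-- The quantity in the definition of `φ`-consistency, with `R_T w` the evaluation of `w` at the
nodes. -/
def consistencyError (Ω : Set (Sp d)) (κ w : Sp d → ℝ) : ℝ :=
  T.edgeSum
    (fun i j => T.hh i j / T.m i j * (T.kap κ i j)⁻¹ *
      |T.flux Ω κ w i j - T.kap κ i j * (T.m i j / T.hh i j) * (w (T.node j) - w (T.node i))| ^ 2)
    (fun i y => T.bh i y / T.bm Ω i y * (T.kbar κ i)⁻¹ *
      |T.bflux Ω κ w i y - T.kbar κ i * (T.bm Ω i y / T.bh i y) * (w y - w (T.node i))| ^ 2)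

/-- `v` solves the finite volume scheme with homogeneous Dirichlet condition
`- ∑_{j ∼ i} (m_ij / h_ij) κ_ij S(π_i, π_j) (v_j / π_j - v_i / π_i) = ∫_{Ω_i} f`, where `p` is the
function `π` and `v` vanishes at the boundary nodes. -/
def SolvesScheme (Ω : Set (Sp d)) (κ p f : Sp d → ℝ) (S : ℝ → ℝ → ℝ) (v : Fin T.N → ℝ) : Prop :=
  ∀ i,
    -((∑ j ∈ T.nbrs i, T.m i j / T.hh i j * T.kap κ i j * S (p (T.node i)) (p (T.node j)) *
        (v j / p (T.node j) - v i / p (T.node i)))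
      + ∑ y ∈ T.bnode i, T.bm Ω i y / T.bh i y * T.kbar κ i * S (p (T.node i)) (p y) *
        (0 / p y - v i / p (T.node i)))
      = ∫ x in T.cell i, f x

end Mesh

/-- The family of meshes `T h`, `h ∈ H`, is `φ`-consistent on `B`; `c w` is the constant that the
definition provides for `w ∈ B`. -/
def IsPhiConsistent {d : ℕ} (Ω : Set (Sp d)) (κ : Sp d → ℝ) (H : Set ℝ) (T : ℝ → Mesh d)
    (φ : ℝ → ℝ) (B : Set (Sp d → ℝ)) (c : (Sp d → ℝ) → ℝ) : Prop :=
  ∀ w ∈ B, 0 ≤ c w ∧ ∀ h ∈ H, (T h).consistencyError Ω κ w ≤ c w * φ h ^ 2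

end StolarskyFV

end

/-!
Write `p = e^{-V}` and `U = u / p`. The equation for `u` is the symmetric equation
`-∇·(pκ∇U) = f`, so by Gauss's formula on a cell the integral of `f` is the sum of the exact fluxes
`∫ pκ ∇U · ν` through its faces. Hence `e_i = v_i / p_i - U(x_i)` solves the scheme with the
residuals `r_ij = ∫ pκ ∇U · ν - (m_ij / h_ij) κ_ij S(p_i, p_j) (U(x_j) - U(x_i))` on the right.
Testing with `e` and using Young's inequality on each interface bounds the discrete energy of `e`
by `∑ r_ij² / ((m_ij / h_ij) κ_ij S(p_i, p_j))`. A mean lies between its arguments and `p` is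
Lipschitz, so replacing `p` by `S(p_i, p_j)` in the exact flux costs `O(h m_ij)`; what remains of
`r_ij` is `S(p_i, p_j)` times the consistency error of `U`, and the weights `m_ij h_ij` add up to
`d |Ω|`.

The discrete error is `p_i e_i`. Its norm is controlled by the energy of `e` through a discrete
Poincaré inequality, which comes from summing `e_i²` by parts against the fluxes of the position
vector `x - x₀`: its divergence is the constant `d`.

Gauss's formula on a convex polytope `C ∋ x₀` comes from integrating by parts against the
Lipschitz cutoff that is `1` where the Minkowski gauge of `C` is at most `r` and decreases
linearly in the gauge to `0` at the boundary. On the cone over a face the gauge is affine, so the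
gradient of the cutoff is a constant multiple of the normal, and the integral over the cone is an
average over `t ∈ (r, 1)` of integrals over the face scaled by `t`; the limit `r → 1` is the
surface integral. Functions that are `C¹` up to the boundary of `Ω` are Lipschitz there, although
`Ω` is not convex: by a Hoffman bound the distance of two points in polytopes that meet controls
their distances to the intersection.
-/

noncomputable section

namespace StolarskyFV

variable {d : ℕ}

open Set Filter Topology

section Hyperplane

variable {E : Type*} [NormedAddCommGroup E] [InnerProductSpace ℝ E] {ν p q a x : E} {c : ℝ}

/-- The hyperplane with normal `ν` (for `ν ≠ 0`) and offset `c`. -/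
def hyperplane (ν : E) (c : ℝ) : Set E := {x | inner ℝ ν x = c}

theorem mem_hyperplane : x ∈ hyperplane ν c ↔ inner ℝ ν x = c := Iff.rfl

theorem hyperplane_nonempty (hν : ν ≠ 0) (c : ℝ) : (hyperplane ν c).Nonempty := by
  refine ⟨(c / ‖ν‖ ^ 2) • ν, ?_⟩
  have : ‖ν‖ ≠ 0 := norm_ne_zero_iff.2 hν
  rw [mem_hyperplane, inner_smul_right, real_inner_self_eq_norm_sq]
  field_simp

theorem hyperplane_neg (ν : E) (c : ℝ) : hyperplane (-ν) (-c) = hyperplane ν c := by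
  ext x
  simp [mem_hyperplane]

theorem coe_mk'_orthogonal (hp : p ∈ hyperplane ν c) :
    (AffineSubspace.mk' p (ℝ ∙ ν)ᗮ : Set E) = hyperplane ν c := by
  ext x
  simp [AffineSubspace.mem_mk', Submodule.mem_orthogonal_singleton_iff_inner_right,
    inner_sub_right, mem_hyperplane, mem_hyperplane.1 hp, sub_eq_zero]

theorem inner_le_of_mem_closure {A : Set E} (hA : ∀ x ∈ A, inner ℝ ν x < c)
    (hx : x ∈ closure A) : inner ℝ ν x ≤ c :=
  closure_minimal (t := {x | inner ℝ ν x ≤ c}) (fun y hy => (hA y hy).le)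
    (isClosed_le (by fun_prop) continuous_const) hx

theorem le_inner_of_mem_closure {A : Set E} (hA : ∀ x ∈ A, c < inner ℝ ν x)
    (hx : x ∈ closure A) : c ≤ inner ℝ ν x :=
  closure_minimal (t := {x | c ≤ inner ℝ ν x}) (fun y hy => (hA y hy).le)
    (isClosed_le continuous_const (by fun_prop)) hx

theorem infDist_hyperplane (hν : ‖ν‖ = 1) (c : ℝ) (x : E) :
    Metric.infDist x (hyperplane ν c) = |c - inner ℝ ν x| := by
  have hν0 : ν ≠ 0 := norm_ne_zero_iff.1 (hν ▸ one_ne_zero)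
  apply le_antisymm
  · have hmem : x + (c - inner ℝ ν x) • ν ∈ hyperplane ν c := by
      simp [mem_hyperplane, inner_add_right, inner_smul_right, hν]
    refine (Metric.infDist_le_dist_of_mem hmem).trans ?_
    rw [dist_self_add_right, norm_smul, hν, mul_one, Real.norm_eq_abs]
  · refine (Metric.le_infDist (hyperplane_nonempty hν0 c)).2 fun y hy => ?_
    rw [← mem_hyperplane.1 hy, ← inner_sub_right, dist_comm, dist_eq_norm]
    have h := abs_real_inner_le_norm ν (y - x)
    rwa [hν, one_mul] at h

/-- The unit vector pointing from `x` to `y`; it is `0` if `x = y`. -/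
def direction (x y : E) : E := (dist x y)⁻¹ • (y - x)

theorem direction_comm (x y : E) : direction y x = -direction x y := by
  rw [direction, direction, dist_comm, ← smul_neg, neg_sub]

theorem norm_direction (h : x ≠ p) : ‖direction x p‖ = 1 := by
  rw [direction, norm_smul, norm_inv, Real.norm_of_nonneg dist_nonneg, dist_comm, dist_eq_norm,
    inv_mul_cancel₀ (norm_ne_zero_iff.2 (sub_ne_zero.2 h.symm))]

theorem direction_ne_zero (h : x ≠ p) : direction x p ≠ 0 :=
  norm_ne_zero_iff.1 (norm_direction h ▸ one_ne_zero)

theorem inner_direction_right (x y : E) :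
    inner ℝ (direction x y) y = inner ℝ (direction x y) x + dist x y := by
  rw [← sub_eq_iff_eq_add', ← inner_sub_right, direction, real_inner_smul_left,
    real_inner_self_eq_norm_sq, ← dist_eq_norm, dist_comm y x, sq, ← mul_assoc, inv_mul_mul_self]

theorem inner_direction_eq_of_inner_sub_eq_zero {y : E} (h : inner ℝ (y - x) (p - q) = 0) :
    inner ℝ (direction x y) p = inner ℝ (direction x y) q := by
  rw [← sub_eq_zero, ← inner_sub_right, direction, real_inner_smul_left, h, mul_zero]

theorem lt_or_gt_of_disjoint_hyperplane {A : Set E} (hA : Convex ℝ A)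
    (h : Disjoint A (hyperplane ν c)) :
    (∀ x ∈ A, inner ℝ ν x < c) ∨ ∀ x ∈ A, c < inner ℝ ν x := by
  by_contra! hcon
  obtain ⟨⟨x, hx, hxc⟩, y, hy, hyc⟩ := hcon
  have hcont : ContinuousOn (fun z : E => inner ℝ ν z) A := by fun_prop
  obtain ⟨z, hz, hzc⟩ := hA.isPreconnected.intermediate_value hy hx hcont ⟨hyc, hxc⟩
  exact disjoint_left.1 h hz hzc

/-- The height of `x` above `a` in the direction `ν`, in units of the height of the hyperplane
`hyperplane ν c` above `a`: it is affine, `0` at `a` and `1` on the hyperplane. -/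
def relHeight (ν : E) (c : ℝ) (a x : E) : ℝ :=
  (inner ℝ ν x - inner ℝ ν a) / (c - inner ℝ ν a)

theorem continuous_relHeight : Continuous (relHeight ν c a) := by
  unfold relHeight
  fun_prop

theorem relHeight_lineMap (t : ℝ) :
    relHeight ν c a (AffineMap.lineMap a x t) = t * relHeight ν c a x := by
  rw [relHeight, relHeight, AffineMap.lineMap_apply_module', inner_add_right, inner_smul_right,
    inner_sub_right]
  ring

theorem relHeight_eq_one_iff (ha : inner ℝ ν a ≠ c) :
    relHeight ν c a x = 1 ↔ x ∈ hyperplane ν c := by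
  rw [relHeight, div_eq_one_iff_eq (sub_ne_zero.2 ha.symm), sub_left_inj, mem_hyperplane]

theorem relHeight_lineMap_of_mem (ha : inner ℝ ν a ≠ c) (hx : x ∈ hyperplane ν c) (t : ℝ) :
    relHeight ν c a (AffineMap.lineMap a x t) = t := by
  rw [relHeight_lineMap, (relHeight_eq_one_iff ha).2 hx, mul_one]

/-- The central projection with centre `a` onto the hyperplane `hyperplane ν c`. It is meaningful
at points `x` whose line through `a` is not parallel to the hyperplane. -/
def centralProjection (ν : E) (c : ℝ) (a x : E) : E :=
  AffineMap.lineMap a x (relHeight ν c a x)⁻¹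

theorem centralProjection_mem_hyperplane (ha : inner ℝ ν a ≠ c) (hx : relHeight ν c a x ≠ 0) :
    centralProjection ν c a x ∈ hyperplane ν c := by
  rw [← relHeight_eq_one_iff ha, centralProjection, relHeight_lineMap, inv_mul_cancel₀ hx]

theorem lineMap_centralProjection (hx : relHeight ν c a x ≠ 0) :
    AffineMap.lineMap a (centralProjection ν c a x) (relHeight ν c a x) = x := by
  rw [centralProjection, AffineMap.lineMap_lineMap_right, mul_inv_cancel₀ hx,
    AffineMap.lineMap_apply_one]

theorem centralProjection_lineMap (ha : inner ℝ ν a ≠ c) (hx : x ∈ hyperplane ν c) {t : ℝ}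
    (ht : t ≠ 0) : centralProjection ν c a (AffineMap.lineMap a x t) = x := by
  rw [centralProjection, relHeight_lineMap_of_mem ha hx, AffineMap.lineMap_lineMap_right,
    inv_mul_cancel₀ ht, AffineMap.lineMap_apply_one]

theorem eventually_relHeight_pos (ha : inner ℝ ν a ≠ c) (hp : p ∈ hyperplane ν c) :
    ∀ᶠ x in 𝓝 p, 0 < relHeight ν c a x :=
  continuous_relHeight.continuousAt.eventually_const_lt
    (((relHeight_eq_one_iff ha).2 hp).symm ▸ one_pos)

theorem tendsto_centralProjection (ha : inner ℝ ν a ≠ c) (hp : p ∈ hyperplane ν c) :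
    Tendsto (centralProjection ν c a) (𝓝 p) (𝓝[hyperplane ν c] p) := by
  have hp1 : relHeight ν c a p = 1 := (relHeight_eq_one_iff ha).2 hp
  refine tendsto_nhdsWithin_iff.2 ⟨?_, ?_⟩
  · have hcont : ContinuousAt (centralProjection ν c a) p := by
      have hp0 : relHeight ν c a p ≠ 0 := hp1 ▸ one_ne_zero
      have := continuous_relHeight (ν := ν) (c := c) (a := a)
      unfold centralProjection
      simp only [AffineMap.lineMap_apply_module']
      fun_prop (disch := assumption)
    have hfix : centralProjection ν c a p = p := by
      rw [centralProjection, hp1, inv_one, AffineMap.lineMap_apply_one]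
    simpa only [hfix] using hcont.tendsto
  · filter_upwards [eventually_relHeight_pos ha hp] with x hx
    exact centralProjection_mem_hyperplane ha hx.ne'

theorem eventually_mem_of_inner_le {K : Set E} (hK : Convex ℝ K) (hp : p ∈ hyperplane ν c)
    (ha : a ∈ K) (hac : inner ℝ ν a < c) (hev : ∀ᶠ q in 𝓝[hyperplane ν c] p, q ∈ K) :
    ∀ᶠ x in 𝓝 p, inner ℝ ν x ≤ c → x ∈ K := by
  filter_upwards [eventually_relHeight_pos hac.ne hp,
    (tendsto_centralProjection hac.ne hp).eventually hev] with x hx hxK hxc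
  rw [← lineMap_centralProjection hx.ne']
  exact hK.lineMap_mem ha hxK ⟨hx.le, (div_le_one (sub_pos.2 hac)).2 (by linarith)⟩

/-- The isometric parametrisation of the hyperplane with normal `ν` through `p` by the orthogonal
complement of `ν`. -/
def orthogonalParam (ν p : E) : (ℝ ∙ ν)ᗮ →ᵃⁱ[ℝ] E :=
  (AffineIsometryEquiv.constVAdd ℝ E p).toAffineIsometry.comp
    (ℝ ∙ ν)ᗮ.subtypeₗᵢ.toAffineIsometry

@[simp]
theorem orthogonalParam_apply (w : (ℝ ∙ ν)ᗮ) : orthogonalParam ν p w = p + w := rfl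

theorem range_orthogonalParam (hp : p ∈ hyperplane ν c) :
    range (orthogonalParam ν p) = hyperplane ν c := by
  ext x
  rw [← coe_mk'_orthogonal hp, SetLike.mem_coe, AffineSubspace.mem_mk']
  exact ⟨fun ⟨w, hw⟩ => by simp [← hw], fun hx => ⟨⟨x -ᵥ p, hx⟩, by simp⟩⟩

theorem map_orthogonalParam_nhds (hp : p ∈ hyperplane ν c) (w : (ℝ ∙ ν)ᗮ) :
    map (orthogonalParam ν p) (𝓝 w) = 𝓝[hyperplane ν c] (orthogonalParam ν p w) := by
  rw [(orthogonalParam ν p).isometry.isEmbedding.map_nhds_eq, range_orthogonalParam hp]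

theorem preimage_frontier_subset {F : Type*} [NormedAddCommGroup F] [NormedSpace ℝ F]
    {A : Set E} (hAo : IsOpen A) (hA : Convex ℝ A) (g : F →ᴬ[ℝ] E) {w₀ : F} (hw₀ : g w₀ ∈ A) :
    g ⁻¹' frontier A ⊆ frontier (g ⁻¹' A) := by
  intro w hw
  rw [mem_preimage, hAo.frontier_eq] at hw
  rw [(hAo.preimage g.continuous).frontier_eq]
  refine ⟨?_, hw.2⟩
  have hlim : Tendsto (AffineMap.lineMap w₀ w) (𝓝[<] (1 : ℝ)) (𝓝 w) := by
    simpa using ((AffineMap.lineMap_continuous (R := ℝ) (p := w₀) (q := w)).tendsto 1).mono_left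
      nhdsWithin_le_nhds
  refine mem_closure_of_tendsto hlim ?_
  filter_upwards [Ioo_mem_nhdsLT one_pos] with t ht
  have hseg : openSegment ℝ (g w₀) (g w) ⊆ A := by
    simpa only [hAo.interior_eq] using hA.openSegment_interior_closure_subset_interior
      (hAo.interior_eq.symm ▸ hw₀) hw.1
  refine hseg ?_
  rw [openSegment_eq_image_lineMap]
  exact ⟨t, ht, (g.toAffineMap.apply_lineMap w₀ w t).symm⟩

section Measure

variable [FiniteDimensional ℝ E] [MeasurableSpace E] [BorelSpace E]

/-- The Hausdorff measure of codimension one, normalised to agree with Lebesgue measure on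
hyperplanes. -/
abbrev surfaceMeasure (E : Type*) [NormedAddCommGroup E] [InnerProductSpace ℝ E]
    [MeasurableSpace E] [BorelSpace E] : Measure E := μHE[Module.finrank ℝ E - 1]

theorem surfaceMeasure_inter_hyperplane (hν : ν ≠ 0) (hp : p ∈ hyperplane ν c) (A : Set E) :
    surfaceMeasure E (A ∩ hyperplane ν c) = volume (orthogonalParam ν p ⁻¹' A) := by
  have hdim : Module.finrank ℝ (ℝ ∙ ν)ᗮ = Module.finrank ℝ E - 1 := by
    have := (ℝ ∙ ν).finrank_add_finrank_orthogonal
    rw [finrank_span_singleton hν] at this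
    omega
  rw [← range_orthogonalParam hp, ← InnerProductSpace.euclideanHausdorffMeasure_eq_volume,
    (orthogonalParam ν p).isometry.euclideanHausdorffMeasure_preimage, hdim]

theorem surfaceMeasure_lt_top (hν : ν ≠ 0) {A : Set E} (hA : Bornology.IsBounded A)
    (hAH : A ⊆ hyperplane ν c) : surfaceMeasure E A < ⊤ := by
  obtain ⟨p, hp⟩ := hyperplane_nonempty hν c
  rw [← inter_eq_left.2 hAH, surfaceMeasure_inter_hyperplane hν hp]
  exact ((orthogonalParam ν p).isometry.antilipschitz.isBounded_preimage hA).measure_lt_top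

theorem isFiniteMeasure_restrict_surfaceMeasure (hν : ν ≠ 0) {A : Set E}
    (hA : Bornology.IsBounded A) (hAH : A ⊆ hyperplane ν c) :
    IsFiniteMeasure ((surfaceMeasure E).restrict A) :=
  ⟨by rw [Measure.restrict_apply_univ]; exact surfaceMeasure_lt_top hν hA hAH⟩

theorem integrableOn_surfaceMeasure {F : Type*} [NormedAddCommGroup F] (hν : ν ≠ 0) {A : Set E}
    (hA : IsCompact A) (hAH : A ⊆ hyperplane ν c) {f : E → F} (hf : ContinuousOn f A) :
    IntegrableOn f A (surfaceMeasure E) :=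
  hf.integrableOn_of_subset_isCompact hA hA.measurableSet Subset.rfl
    (surfaceMeasure_lt_top hν hA.isBounded hAH).ne

theorem surfaceMeasure_affineSubspace_inter (hν : ν ≠ 0) (B : AffineSubspace ℝ E)
    (hq : q ∈ hyperplane ν c) (hqB : q ∉ B) :
    surfaceMeasure E ((B : Set E) ∩ hyperplane ν c) = 0 := by
  rw [surfaceMeasure_inter_hyperplane hν hq]
  refine Measure.addHaar_affineSubspace _ (B.comap (orthogonalParam ν q).toAffineMap)
    fun h => hqB ?_
  have h0 : (0 : (ℝ ∙ ν)ᗮ) ∈ B.comap (orthogonalParam ν q).toAffineMap := by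
    rw [h]; exact AffineSubspace.mem_top ..
  simpa using h0

theorem affineSpan_eq_hyperplane (hν : ν ≠ 0) {A : Set E} (hAH : A ⊆ hyperplane ν c)
    (hA : 0 < surfaceMeasure E A) : (affineSpan ℝ A : Set E) = hyperplane ν c := by
  apply Subset.antisymm
  · obtain ⟨p, hp⟩ := hyperplane_nonempty hν c
    rw [← coe_mk'_orthogonal hp] at hAH ⊢
    exact affineSpan_le.2 hAH
  · intro q hq
    by_contra hqB
    have hA0 : A ⊆ (affineSpan ℝ A : Set E) ∩ hyperplane ν c :=
      subset_inter (subset_affineSpan ℝ A) hAH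
    exact hA.ne' (measure_mono_null hA0 (surfaceMeasure_affineSubspace_inter hν _ hq hqB))

theorem hyperplane_subset_of_surfaceMeasure_pos {w : E} {s : ℝ} (hν : ν ≠ 0)
    (h : 0 < surfaceMeasure E (hyperplane w s ∩ hyperplane ν c)) :
    hyperplane ν c ⊆ hyperplane w s := by
  obtain ⟨p, hp, -⟩ := nonempty_of_measure_ne_zero h.ne'
  intro q hq
  by_contra hqB
  rw [← coe_mk'_orthogonal hp] at h hqB
  exact h.ne' (surfaceMeasure_affineSubspace_inter hν _ hq hqB)

theorem exists_smul_of_surfaceMeasure_pos {w : E} {s : ℝ} (hν : ν ≠ 0)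
    (h : 0 < surfaceMeasure E (hyperplane w s ∩ hyperplane ν c)) :
    ∃ t : ℝ, w = t • ν ∧ s = t * c := by
  have hsub := hyperplane_subset_of_surfaceMeasure_pos hν h
  obtain ⟨p, hp⟩ := hyperplane_nonempty hν c
  have hwν : w ∈ (ℝ ∙ ν)ᗮᗮ := by
    rw [Submodule.mem_orthogonal']
    intro u hu
    have hpu : orthogonalParam ν p ⟨u, hu⟩ ∈ hyperplane w s :=
      hsub (range_orthogonalParam hp ▸ mem_range_self _)
    rw [mem_hyperplane, orthogonalParam_apply, inner_add_right, mem_hyperplane.1 (hsub hp)] at hpu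
    linarith
  rw [Submodule.orthogonal_orthogonal] at hwν
  obtain ⟨t, rfl⟩ := Submodule.mem_span_singleton.1 hwν
  exact ⟨t, rfl, by
    rw [← mem_hyperplane.1 (hsub hp), real_inner_smul_left, mem_hyperplane.1 hp]⟩

theorem surfaceMeasure_frontier_inter_hyperplane {A : Set E} (hAo : IsOpen A) (hA : Convex ℝ A)
    (hν : ν ≠ 0) (h : (A ∩ hyperplane ν c).Nonempty) :
    surfaceMeasure E (frontier A ∩ hyperplane ν c) = 0 := by
  obtain ⟨p, hpA, hp⟩ := h
  rw [surfaceMeasure_inter_hyperplane hν hp]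
  exact measure_mono_null (preimage_frontier_subset hAo hA
      (orthogonalParam ν p).toContinuousAffineMap (w₀ := 0) (by simpa using hpA))
    ((hA.affine_preimage (orthogonalParam ν p).toAffineMap).addHaar_frontier volume)

theorem opposite_sides {A B : Set E} (hAo : IsOpen A) (hBo : IsOpen B) (hA : Convex ℝ A)
    (hB : Convex ℝ B) (hAB : Disjoint A B) (hν : ν ≠ 0)
    (h : 0 < surfaceMeasure E (closure A ∩ closure B ∩ hyperplane ν c)) :
    ((∀ x ∈ A, inner ℝ ν x < c) ∧ ∀ x ∈ B, c < inner ℝ ν x) ∨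
      ((∀ x ∈ A, c < inner ℝ ν x) ∧ ∀ x ∈ B, inner ℝ ν x < c) := by
  obtain ⟨f, s, hfA, hfB⟩ := geometric_hahn_banach_open_open hA hAo hB hBo hAB
  obtain ⟨w, rfl⟩ := (InnerProductSpace.toDual ℝ E).surjective f
  simp only [InnerProductSpace.toDual_apply_apply] at hfA hfB
  have hsub : closure A ∩ closure B ⊆ hyperplane w s := fun x hx =>
    (inner_le_of_mem_closure hfA hx.1).antisymm <| by
      simpa using inner_le_of_mem_closure (ν := -w) (c := -s) (by simpa using hfB) hx.2
  obtain ⟨t, rfl, rfl⟩ := exists_smul_of_surfaceMeasure_pos hν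
    (h.trans_le (measure_mono (inter_subset_inter_left _ hsub)))
  simp only [real_inner_smul_left] at hfA hfB
  rcases lt_trichotomy t 0 with ht | rfl | ht
  · exact Or.inr ⟨fun x hx => (mul_lt_mul_left_of_neg ht).1 (hfA x hx),
      fun x hx => (mul_lt_mul_left_of_neg ht).1 (hfB x hx)⟩
  · obtain ⟨x, ⟨hx, -⟩, -⟩ := nonempty_of_measure_ne_zero h.ne'
    obtain ⟨y, hy⟩ := closure_nonempty_iff.1 ⟨x, hx⟩
    simpa using hfA y hy
  · exact Or.inl ⟨fun x hx => lt_of_mul_lt_mul_left (hfA x hx) ht.le,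
      fun x hx => lt_of_mul_lt_mul_left (hfB x hx) ht.le⟩

theorem surfaceMeasure_inter_diff_interior_union {K L : Set E} {b : E} (hK : Convex ℝ K)
    (hL : Convex ℝ L) (hν : ν ≠ 0) (ha : a ∈ K) (hac : inner ℝ ν a < c) (hb : b ∈ L)
    (hbc : c < inner ℝ ν b) :
    surfaceMeasure E ((K ∩ L) \ interior (K ∪ L) ∩ hyperplane ν c) = 0 := by
  obtain ⟨p, hp⟩ := hyperplane_nonempty hν c
  rw [surfaceMeasure_inter_hyperplane hν hp]
  refine measure_mono_null ?_ (((hK.inter hL).affine_preimage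
    (orthogonalParam ν p).toAffineMap).addHaar_frontier volume)
  rintro w ⟨hw, hwi⟩
  refine ⟨subset_closure hw, fun hint => hwi ?_⟩
  have hev : ∀ᶠ q in 𝓝[hyperplane ν c] (orthogonalParam ν p w), q ∈ K ∩ L := by
    rw [← map_orthogonalParam_nhds hp]
    exact mem_interior_iff_mem_nhds.1 hint
  have hwH : orthogonalParam ν p w ∈ hyperplane ν c :=
    range_orthogonalParam hp ▸ mem_range_self w
  have hbelow := eventually_mem_of_inner_le hK hwH ha hac (hev.mono fun _ h => h.1)
  rw [← hyperplane_neg] at hev hwH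
  have habove := eventually_mem_of_inner_le hL hwH hb (by simpa using hbc)
    (hev.mono fun _ h => h.2)
  rw [mem_interior_iff_mem_nhds]
  filter_upwards [hbelow, habove] with x hxK hxL
  rcases le_total (inner ℝ ν x) c with h | h
  · exact Or.inl (hxK h)
  · exact Or.inr (hxL (by simpa using h))

end Measure

end Hyperplane

section Cone

variable {E : Type*} [NormedAddCommGroup E] [InnerProductSpace ℝ E] {x₀ x ν : E} {c : ℝ}
  {σ : Set E} {I : Set ℝ}

/-- The part of the cone over `σ` with apex `x₀` at the relative heights `t ∈ I`: the apex has
height `0` and `σ` has height `1`. -/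
def cone (x₀ : E) (σ : Set E) (I : Set ℝ) : Set E :=
  image2 (fun y t => AffineMap.lineMap x₀ y t) σ I

theorem mem_cone_iff (hx₀ : inner ℝ ν x₀ ≠ c) (hσ : σ ⊆ hyperplane ν c) (hI : I ⊆ Ioi 0) :
    x ∈ cone x₀ σ I ↔ relHeight ν c x₀ x ∈ I ∧ centralProjection ν c x₀ x ∈ σ := by
  constructor
  · rintro ⟨y, hy, t, ht, rfl⟩
    rw [relHeight_lineMap_of_mem hx₀ (hσ hy),
      centralProjection_lineMap hx₀ (hσ hy) (mem_Ioi.1 (hI ht)).ne']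
    exact ⟨ht, hy⟩
  · rintro ⟨ht, hy⟩
    exact ⟨_, hy, _, ht, lineMap_centralProjection (mem_Ioi.1 (hI ht)).ne'⟩

theorem inter_cone_inter_relHeight_fiber (hx₀ : inner ℝ ν x₀ ≠ c) (hσ : σ ⊆ hyperplane ν c)
    (A : Set E) {t : ℝ} (ht : t ∈ I) :
    A ∩ cone x₀ σ I ∩ relHeight ν c x₀ ⁻¹' {t} =
      AffineMap.homothety x₀ t '' ((fun y => AffineMap.lineMap x₀ y t) ⁻¹' A ∩ σ) := by
  ext x
  constructor
  · rintro ⟨⟨hxA, y, hy, s, _, rfl⟩, hx⟩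
    rw [mem_preimage, mem_singleton_iff, relHeight_lineMap_of_mem hx₀ (hσ hy)] at hx
    subst hx
    exact ⟨y, ⟨hxA, hy⟩, rfl⟩
  · rintro ⟨y, ⟨hyA, hy⟩, rfl⟩
    exact ⟨⟨hyA, y, hy, t, ht, rfl⟩, relHeight_lineMap_of_mem hx₀ (hσ hy) t⟩

theorem inter_cone_inter_relHeight_fiber_of_notMem (hx₀ : inner ℝ ν x₀ ≠ c)
    (hσ : σ ⊆ hyperplane ν c) (A : Set E) {t : ℝ} (ht : t ∉ I) :
    A ∩ cone x₀ σ I ∩ relHeight ν c x₀ ⁻¹' {t} = ∅ := by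
  rw [eq_empty_iff_forall_notMem]
  rintro x ⟨⟨-, y, hy, s, hs, rfl⟩, hx⟩
  rw [mem_preimage, mem_singleton_iff, relHeight_lineMap_of_mem hx₀ (hσ hy)] at hx
  exact ht (hx ▸ hs)

theorem continuous_lineMap_prod (x₀ : E) :
    Continuous fun p : ℝ × E => (AffineMap.lineMap x₀ p.2 p.1 : E) := by
  simp only [AffineMap.lineMap_apply_module']
  fun_prop

variable [MeasurableSpace E] [BorelSpace E]

theorem measurableSet_cone [FiniteDimensional ℝ E] (hx₀ : inner ℝ ν x₀ ≠ c)
    (hσ : σ ⊆ hyperplane ν c) (hσm : MeasurableSet σ) (hIm : MeasurableSet I) (hI : I ⊆ Ioi 0) :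
    MeasurableSet (cone x₀ σ I) := by
  have hheight : Measurable (relHeight ν c x₀) := continuous_relHeight.measurable
  have hproj : Measurable (centralProjection ν c x₀) := by
    have (x : E) : centralProjection ν c x₀ x = (relHeight ν c x₀ x)⁻¹ • (x - x₀) + x₀ :=
      AffineMap.lineMap_apply_module' x₀ x _
    rw [funext this]
    fun_prop
  have hcone : cone x₀ σ I = relHeight ν c x₀ ⁻¹' I ∩ centralProjection ν c x₀ ⁻¹' σ := by
    ext x
    exact mem_cone_iff hx₀ hσ hI
  rw [hcone]
  exact (hheight hIm).inter (hproj hσm)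

/-- The integral of `f` over the image of the face `σ` under the homothety with centre `x₀` and
ratio `t`. -/
def scaledFaceIntegral (x₀ : E) (σ : Set E) (f : E → ℝ) (t : ℝ) : ℝ :=
  t ^ (Module.finrank ℝ E - 1) * ∫ y in σ, f (AffineMap.lineMap x₀ y t) ∂surfaceMeasure E

theorem scaledFaceIntegral_one (x₀ : E) (σ : Set E) (f : E → ℝ) :
    scaledFaceIntegral x₀ σ f 1 = ∫ y in σ, f y ∂surfaceMeasure E := by
  simp [scaledFaceIntegral]

variable [FiniteDimensional ℝ E]

theorem volume_eq_lintegral_relHeight_fiber (hν : ‖ν‖ = 1) (hx₀ : inner ℝ ν x₀ < c) {A : Set E}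
    (hA : MeasurableSet A) :
    volume A = ENNReal.ofReal (c - inner ℝ ν x₀) *
      ∫⁻ t, surfaceMeasure E (A ∩ relHeight ν c x₀ ⁻¹' {t}) := by
  have hδ : 0 < c - inner ℝ ν x₀ := sub_pos.2 hx₀
  have hν0 : ν ≠ 0 := norm_ne_zero_iff.1 (hν ▸ one_ne_zero)
  have hslice : ∀ t : ℝ, (AffineSubspace.mk' (t • (c - inner ℝ ν x₀) • ν +ᵥ x₀)
      (ℝ ∙ (c - inner ℝ ν x₀) • ν)ᗮ : Set E) = relHeight ν c x₀ ⁻¹' {t} := by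
    intro t
    ext x
    simp only [SetLike.mem_coe, AffineSubspace.mem_mk', vsub_eq_sub, vadd_eq_add,
      Submodule.mem_orthogonal_singleton_iff_inner_right, real_inner_smul_left, inner_sub_right,
       inner_add_right, inner_smul_right, real_inner_self_eq_norm_sq, hν,
      mem_preimage, mem_singleton_iff, relHeight, div_eq_iff hδ.ne']
    exact ⟨fun h => mul_left_cancel₀ hδ.ne' (by linarith),
      fun h => by linear_combination (c - inner ℝ ν x₀) * h⟩
  have h := EuclideanGeometry.euclideanHausdorffMeasure_eq_lintegral x₀
    (smul_ne_zero hδ.ne' hν0) hA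
  rw [InnerProductSpace.euclideanHausdorffMeasure_eq_volume] at h
  rw [h, enorm_smul, ← ofReal_norm ν, hν, ENNReal.ofReal_one, mul_one, Real.enorm_eq_ofReal hδ.le]
  simp only [hslice]

theorem volume_inter_cone (hν : ‖ν‖ = 1) (hx₀ : inner ℝ ν x₀ < c) (hσm : MeasurableSet σ)
    (hσ : σ ⊆ hyperplane ν c) (hIm : MeasurableSet I) (hI : I ⊆ Ioi 0) {A : Set E}
    (hA : MeasurableSet A) :
    volume (A ∩ cone x₀ σ I) =
      ∫⁻ t in I, ENNReal.ofReal ((c - inner ℝ ν x₀) * t ^ (Module.finrank ℝ E - 1)) *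
        surfaceMeasure E ((fun y => AffineMap.lineMap x₀ y t) ⁻¹' A ∩ σ) := by
  have hδ : 0 ≤ c - inner ℝ ν x₀ := (sub_pos.2 hx₀).le
  rw [volume_eq_lintegral_relHeight_fiber hν hx₀
      (hA.inter (measurableSet_cone hx₀.ne hσ hσm hIm hI)),
    ← lintegral_const_mul' _ _ ENNReal.ofReal_ne_top, ← lintegral_indicator hIm]
  refine lintegral_congr fun t => ?_
  by_cases ht : t ∈ I
  · have ht0 : 0 ≤ t := (mem_Ioi.1 (hI ht)).le
    have hscale : ((‖t‖₊ ^ (Module.finrank ℝ E - 1) : NNReal) : ENNReal) =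
        ENNReal.ofReal (t ^ (Module.finrank ℝ E - 1)) := by
      rw [ENNReal.ofReal_pow ht0, ENNReal.coe_pow, ← Real.enorm_eq_ofReal ht0]
      rfl
    rw [indicator_of_mem ht, inter_cone_inter_relHeight_fiber hx₀.ne hσ A ht,
      euclideanHausdorffMeasure_homothety_image _ _ (mem_Ioi.1 (hI ht)).ne',
      ENNReal.ofReal_mul hδ, mul_assoc, ENNReal.smul_def, smul_eq_mul, hscale]
  · rw [indicator_of_notMem ht, inter_cone_inter_relHeight_fiber_of_notMem hx₀.ne hσ A ht,
      measure_empty, mul_zero]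

theorem volume_restrict_cone (hν : ‖ν‖ = 1) (hx₀ : inner ℝ ν x₀ < c) (hσm : MeasurableSet σ)
    (hσ : σ ⊆ hyperplane ν c) [SFinite ((surfaceMeasure E).restrict σ)] (hIm : MeasurableSet I)
    (hI : I ⊆ Ioi 0) :
    volume.restrict (cone x₀ σ I) = Measure.map (fun p : ℝ × E => AffineMap.lineMap x₀ p.2 p.1)
      (((volume.restrict I).withDensity fun t =>
        ENNReal.ofReal ((c - inner ℝ ν x₀) * t ^ (Module.finrank ℝ E - 1))).prod
          ((surfaceMeasure E).restrict σ)) := by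
  have hΦ := (continuous_lineMap_prod x₀).measurable
  ext A hA
  rw [Measure.restrict_apply hA, volume_inter_cone hν hx₀ hσm hσ hIm hI hA,
    Measure.map_apply hΦ hA, Measure.prod_apply (hΦ hA),
    lintegral_withDensity_eq_lintegral_mul _ (by fun_prop)
      (measurable_measure_prodMk_left (hΦ hA))]
  refine lintegral_congr fun t => ?_
  rw [Pi.mul_apply, Measure.restrict_apply (measurable_prodMk_left (hΦ hA))]
  rfl

theorem volume_cone_of_null (hν : ‖ν‖ = 1) (hx₀ : inner ℝ ν x₀ < c) (hσm : MeasurableSet σ)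
    (hσ : σ ⊆ hyperplane ν c) (hIm : MeasurableSet I) (hI : I ⊆ Ioi 0)
    (hnull : surfaceMeasure E σ = 0) : volume (cone x₀ σ I) = 0 := by
  have hzero : (surfaceMeasure E).restrict σ = 0 := Measure.restrict_eq_zero.2 hnull
  have : SFinite ((surfaceMeasure E).restrict σ) := hzero ▸ inferInstance
  rw [← Measure.restrict_eq_zero, volume_restrict_cone hν hx₀ hσm hσ hIm hI, hzero,
    Measure.prod_zero, Measure.map_zero]

theorem continuous_scaledFaceIntegral (hν : ν ≠ 0) (hσc : IsCompact σ) (hσ : σ ⊆ hyperplane ν c)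
    {f : E → ℝ} (hf : Continuous f) : Continuous (scaledFaceIntegral x₀ σ f) := by
  have := isFiniteMeasure_restrict_surfaceMeasure hν hσc.isBounded hσ
  refine (continuous_pow _).mul ?_
  simpa only [Measure.restrict_restrict hσc.measurableSet, inter_self] using
    continuous_parametric_integral_of_continuous (μ := (surfaceMeasure E).restrict σ)
      (f := fun t y => f (AffineMap.lineMap x₀ y t)) (hf.comp (continuous_lineMap_prod x₀)) hσc

theorem integrableOn_cone (hσc : IsCompact σ) {r : ℝ} {f : E → ℝ} (hf : Continuous f) :
    IntegrableOn f (cone x₀ σ (Ioo r 1)) := by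
  have hcompact : IsCompact (cone x₀ σ (Icc r 1)) := by
    rw [cone, ← image_prod]
    exact (hσc.prod isCompact_Icc).image ((continuous_lineMap_prod x₀).comp continuous_swap)
  exact (hf.continuousOn.integrableOn_compact hcompact).mono_set
    (image2_subset_left Ioo_subset_Icc_self)

theorem setIntegral_cone (hν : ‖ν‖ = 1) (hx₀ : inner ℝ ν x₀ < c) (hσc : IsCompact σ)
    (hσ : σ ⊆ hyperplane ν c) {r : ℝ} (hr : 0 ≤ r) (hr1 : r ≤ 1) {f : E → ℝ} (hf : Continuous f) :
    ∫ x in cone x₀ σ (Ioo r 1), f x =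
      (c - inner ℝ ν x₀) * ∫ t in r..1, scaledFaceIntegral x₀ σ f t := by
  have hν0 : ν ≠ 0 := norm_ne_zero_iff.1 (hν ▸ one_ne_zero)
  have hI : Ioo r 1 ⊆ Ioi 0 := fun t ht => hr.trans_lt ht.1
  have hΦ := continuous_lineMap_prod x₀
  have := isFiniteMeasure_restrict_surfaceMeasure hν0 hσc.isBounded hσ
  have hint := integrableOn_cone (x₀ := x₀) (r := r) hσc hf
  rw [IntegrableOn, volume_restrict_cone hν hx₀ hσc.measurableSet hσ measurableSet_Ioo hI,
    integrable_map_measure hf.aestronglyMeasurable hΦ.measurable.aemeasurable] at hint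
  rw [volume_restrict_cone hν hx₀ hσc.measurableSet hσ measurableSet_Ioo hI,
    integral_map hΦ.measurable.aemeasurable hf.aestronglyMeasurable,
    integral_prod (fun p : ℝ × E => f (AffineMap.lineMap x₀ p.2 p.1)) hint,
    integral_withDensity_eq_integral_toReal_smul (by fun_prop) (by simp),
    ← intervalIntegral.integral_const_mul, intervalIntegral.integral_of_le hr1,
    integral_Ioc_eq_integral_Ioo]
  refine setIntegral_congr_fun measurableSet_Ioo fun t ht => ?_
  have hdensity : 0 ≤ (c - inner ℝ ν x₀) * t ^ (Module.finrank ℝ E - 1) :=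
    mul_nonneg (sub_pos.2 hx₀).le (pow_nonneg (mem_Ioi.1 (hI ht)).le _)
  simp only [ENNReal.toReal_ofReal hdensity, smul_eq_mul, scaledFaceIntegral, mul_assoc]

end Cone

section Gauge

variable {E : Type*} [NormedAddCommGroup E] {C : Set E} {x₀ x : E} {r : ℝ}

theorem preimage_add_mem_nhds (hCo : IsOpen C) (hx₀ : x₀ ∈ C) : (x₀ + ·) ⁻¹' C ∈ 𝓝 (0 : E) :=
  (hCo.preimage (by fun_prop)).mem_nhds (by simpa using hx₀)

variable [NormedSpace ℝ E]

/-- The Minkowski gauge of `C` with respect to the centre `x₀`. -/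
def centeredGauge (C : Set E) (x₀ x : E) : ℝ := gauge ((x₀ + ·) ⁻¹' C) (x - x₀)

theorem centeredGauge_nonneg : 0 ≤ centeredGauge C x₀ x := gauge_nonneg _

theorem lineMap_lineMap_inv {t : ℝ} (ht : t ≠ 0) :
    (AffineMap.lineMap x₀ (AffineMap.lineMap x₀ x t⁻¹ : E) t : E) = x := by
  rw [AffineMap.lineMap_lineMap_right, mul_inv_cancel₀ ht, AffineMap.lineMap_apply_one]

theorem centeredGauge_lineMap {t : ℝ} (ht : 0 ≤ t) :
    centeredGauge C x₀ (AffineMap.lineMap x₀ x t) = t * centeredGauge C x₀ x := by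
  rw [centeredGauge, centeredGauge, AffineMap.lineMap_apply_module', add_sub_cancel_right,
    gauge_smul_of_nonneg ht, smul_eq_mul]

theorem exists_lipschitzWith_centeredGauge (hCo : IsOpen C) (hC : Convex ℝ C) (hx₀ : x₀ ∈ C) :
    ∃ L, LipschitzWith L (centeredGauge C x₀) := by
  obtain ⟨L, hL⟩ :=
    (hC.translate_preimage_right x₀).lipschitz_gauge (preimage_add_mem_nhds hCo hx₀)
  refine ⟨L, LipschitzWith.of_dist_le_mul fun x y => ?_⟩
  simpa only [dist_sub_right, centeredGauge] using hL.dist_le_mul (x - x₀) (y - x₀)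

theorem centeredGauge_lt_one_iff (hCo : IsOpen C) (hC : Convex ℝ C) (hx₀ : x₀ ∈ C) :
    centeredGauge C x₀ x < 1 ↔ x ∈ C := by
  rw [centeredGauge, gauge_lt_one_iff_mem_interior (hC.translate_preimage_right x₀)
    (preimage_add_mem_nhds hCo hx₀), (hCo.preimage (by fun_prop)).interior_eq, mem_preimage,
    add_sub_cancel]

theorem centeredGauge_eq_one_iff (hCo : IsOpen C) (hC : Convex ℝ C) (hx₀ : x₀ ∈ C) :
    centeredGauge C x₀ x = 1 ↔ x ∈ frontier C := by
  have hfrontier := (Homeomorph.addLeft x₀).preimage_frontier C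
  rw [Homeomorph.coe_addLeft] at hfrontier
  rw [centeredGauge, gauge_eq_one_iff_mem_frontier (hC.translate_preimage_right x₀)
    (preimage_add_mem_nhds hCo hx₀), ← hfrontier, mem_preimage, add_sub_cancel]

/-- The cutoff function that equals `1` where the gauge of `C` is at most `r`, vanishes outside `C`
and is affine in the gauge in between. -/
def cutoff (C : Set E) (x₀ : E) (r : ℝ) (x : E) : ℝ :=
  max (min ((1 - r)⁻¹ * (1 - centeredGauge C x₀ x)) 1) 0

theorem cutoff_nonneg : 0 ≤ cutoff C x₀ r x := le_max_right _ _

theorem cutoff_le_one : cutoff C x₀ r x ≤ 1 := max_le (min_le_right _ _) zero_le_one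

theorem cutoff_eq_one (hr : r < 1) (hx : centeredGauge C x₀ x ≤ r) : cutoff C x₀ r x = 1 := by
  have : 1 ≤ (1 - r)⁻¹ * (1 - centeredGauge C x₀ x) := by
    rw [inv_mul_eq_div, one_le_div (by linarith)]
    linarith
  rw [cutoff, min_eq_right this, max_eq_left zero_le_one]

theorem cutoff_eq_zero (hr : r < 1) (hx : 1 ≤ centeredGauge C x₀ x) : cutoff C x₀ r x = 0 :=
  max_eq_right ((min_le_left _ _).trans
    (mul_nonpos_of_nonneg_of_nonpos (inv_nonneg.2 (by linarith)) (by linarith)))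

theorem cutoff_eq_of_mem_Ioo (hx : centeredGauge C x₀ x ∈ Ioo r 1) :
    cutoff C x₀ r x = (1 - r)⁻¹ * (1 - centeredGauge C x₀ x) := by
  have hr : r < 1 := hx.1.trans hx.2
  rw [cutoff, min_eq_left, max_eq_left]
  · exact mul_nonneg (inv_nonneg.2 (by linarith)) (by linarith [hx.2])
  · rw [inv_mul_eq_div, div_le_one (by linarith)]
    linarith [hx.1]

theorem cutoff_eq_zero_of_notMem (hCo : IsOpen C) (hC : Convex ℝ C) (hx₀ : x₀ ∈ C) (hr : r < 1)
    (hx : x ∉ C) : cutoff C x₀ r x = 0 :=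
  cutoff_eq_zero hr (not_lt.1 (mt (centeredGauge_lt_one_iff hCo hC hx₀).1 hx))

theorem exists_lipschitzWith_cutoff (hCo : IsOpen C) (hC : Convex ℝ C) (hx₀ : x₀ ∈ C) (r : ℝ) :
    ∃ L, LipschitzWith L (cutoff C x₀ r) := by
  obtain ⟨L, hL⟩ := exists_lipschitzWith_centeredGauge hCo hC hx₀
  have haffine := (lipschitzWith_smul (1 - r)⁻¹).comp ((LipschitzWith.const (1 : ℝ)).sub hL)
  exact ⟨_, (haffine.min_const 1).max_const 0⟩

theorem hasCompactSupport_cutoff [FiniteDimensional ℝ E] (hCo : IsOpen C) (hC : Convex ℝ C)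
    (hCb : Bornology.IsBounded C) (hx₀ : x₀ ∈ C) (hr : r < 1) :
    HasCompactSupport (cutoff C x₀ r) :=
  HasCompactSupport.intro hCb.isCompact_closure fun _ hx =>
    cutoff_eq_zero_of_notMem hCo hC hx₀ hr (notMem_of_notMem_closure hx)

theorem fderiv_cutoff_eq_zero (hr : r < 1) (hx : centeredGauge C x₀ x ∉ Ioo r 1) :
    fderiv ℝ (cutoff C x₀ r) x = 0 := by
  rw [mem_Ioo, not_and_or, not_lt, not_lt] at hx
  rcases hx with hx | hx
  · refine IsLocalMax.fderiv_eq_zero (Eventually.of_forall fun y => ?_)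
    rw [cutoff_eq_one hr hx]
    exact cutoff_le_one
  · refine IsLocalMin.fderiv_eq_zero (Eventually.of_forall fun y => ?_)
    rw [cutoff_eq_zero hr hx]
    exact cutoff_nonneg

theorem tendsto_setIntegral_mul_cutoff [MeasurableSpace E] [BorelSpace E] {μ : Measure E}
    (hCo : IsOpen C) (hC : Convex ℝ C) (hx₀ : x₀ ∈ C) {f : E → ℝ} (hf : IntegrableOn f C μ) :
    Tendsto (fun r => ∫ x in C, f x * cutoff C x₀ r x ∂μ) (𝓝[<] 1) (𝓝 (∫ x in C, f x ∂μ)) := by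
  refine tendsto_integral_filter_of_dominated_convergence (fun x => ‖f x‖) ?_ ?_ hf.norm ?_
  · refine Eventually.of_forall fun r => ?_
    obtain ⟨L, hL⟩ := exists_lipschitzWith_cutoff hCo hC hx₀ r
    exact hf.aestronglyMeasurable.mul hL.continuous.aestronglyMeasurable
  · refine Eventually.of_forall fun r => Eventually.of_forall fun x => ?_
    rw [norm_mul]
    refine mul_le_of_le_one_right (norm_nonneg _) ?_
    rw [Real.norm_of_nonneg cutoff_nonneg]
    exact cutoff_le_one
  · filter_upwards [ae_restrict_mem hCo.measurableSet] with x hx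
    refine tendsto_const_nhds.congr' ?_
    filter_upwards [Ioo_mem_nhdsLT ((centeredGauge_lt_one_iff hCo hC hx₀).2 hx)] with r hr
    rw [cutoff_eq_one hr.2 hr.1.le, mul_one]

end Gauge

section GaugeHeight

variable {E : Type*} [NormedAddCommGroup E] [InnerProductSpace ℝ E] {C : Set E} {x₀ x ν : E}
  {c r : ℝ}

theorem relHeight_le_centeredGauge (hCo : IsOpen C) (hC : Convex ℝ C) (hx₀ : x₀ ∈ C)
    (hlt : ∀ y ∈ C, inner ℝ ν y < c) (x : E) : relHeight ν c x₀ x ≤ centeredGauge C x₀ x := by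
  refine le_of_forall_gt_imp_ge_of_dense fun s hs => ?_
  have hs0 : 0 < s := centeredGauge_nonneg.trans_lt hs
  have hmem : AffineMap.lineMap x₀ x s⁻¹ ∈ C := by
    rwa [← centeredGauge_lt_one_iff hCo hC hx₀, centeredGauge_lineMap (inv_nonneg.2 hs0.le),
      inv_mul_lt_iff₀ hs0, mul_one]
  have hheight : relHeight ν c x₀ (AffineMap.lineMap x₀ x s⁻¹) < 1 :=
    (div_lt_one (sub_pos.2 (hlt x₀ hx₀))).2 (sub_lt_sub_right (hlt _ hmem) _)
  rw [relHeight_lineMap, inv_mul_lt_iff₀ hs0, mul_one] at hheight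
  exact hheight.le

theorem hasFDerivAt_relHeight :
    HasFDerivAt (relHeight ν c x₀) ((c - inner ℝ ν x₀)⁻¹ • innerSL ℝ ν) x :=
  ((innerSL ℝ ν).hasFDerivAt.sub_const _).mul_const _

-- The cutoff lies below `(1 - r)⁻¹ * (1 - relHeight)` near `x` and touches it at `x`, so the two
-- have the same derivative there.
theorem fderiv_cutoff_of_relHeight_eq (hCo : IsOpen C) (hC : Convex ℝ C) (hx₀ : x₀ ∈ C)
    (hlt : ∀ y ∈ C, inner ℝ ν y < c) (hx : relHeight ν c x₀ x = centeredGauge C x₀ x)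
    (hxr : centeredGauge C x₀ x ∈ Ioo r 1) (hd : DifferentiableAt ℝ (cutoff C x₀ r) x) (v : E) :
    fderiv ℝ (cutoff C x₀ r) x v = -((1 - r)⁻¹ * (inner ℝ ν v / (c - inner ℝ ν x₀))) := by
  set ℓ : E → ℝ := fun y => (1 - r)⁻¹ * (1 - relHeight ν c x₀ y) with hℓ
  have hℓ' : HasFDerivAt ℓ ((1 - r)⁻¹ • -((c - inner ℝ ν x₀)⁻¹ • innerSL ℝ ν)) x :=
    (hasFDerivAt_relHeight.const_sub 1).const_mul (1 - r)⁻¹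
  have hpos : 0 < (1 - r)⁻¹ := inv_pos.2 (by linarith [hxr.1, hxr.2])
  have htouch : cutoff C x₀ r x = ℓ x := by simp only [cutoff_eq_of_mem_Ioo hxr, hℓ, hx]
  have hbelow : ∀ᶠ y in 𝓝 x, cutoff C x₀ r y ≤ ℓ y := by
    have hℓx : 0 < ℓ x := mul_pos hpos (by rw [hx]; linarith [hxr.2])
    filter_upwards [hℓ'.continuousAt.eventually_const_lt hℓx] with y hy
    refine max_le ((min_le_left _ _).trans ?_) hy.le
    exact mul_le_mul_of_nonneg_left
      (sub_le_sub_left (relHeight_le_centeredGauge hCo hC hx₀ hlt y) 1) hpos.le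
  have hmax : IsLocalMax (fun y => cutoff C x₀ r y - ℓ y) x := by
    filter_upwards [hbelow] with y hy
    rwa [htouch, sub_self, sub_nonpos]
  rw [sub_eq_zero.1 (hmax.hasFDerivAt_eq_zero (hd.hasFDerivAt.sub hℓ'))]
  simp [div_eq_inv_mul]

end GaugeHeight

section Gauss

theorem tendsto_inv_mul_intervalIntegral {A : ℝ → ℝ} (hA : Continuous A) (b : ℝ) :
    Tendsto (fun r => (b - r)⁻¹ * ∫ t in r..b, A t) (𝓝[<] b) (𝓝 (A b)) := by
  have hderiv : HasDerivAt (fun r => ∫ t in r..b, A t) (-A b) b :=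
    intervalIntegral.integral_hasDerivAt_left (hA.intervalIntegrable _ _)
      hA.aestronglyMeasurable.stronglyMeasurableAtFilter hA.continuousAt
  have hslope := (hasDerivAt_iff_tendsto_slope.1 hderiv).neg
  rw [neg_neg] at hslope
  refine (hslope.mono_left (nhdsWithin_mono _ fun x hx => ne_of_lt hx)).congr fun r => ?_
  rw [slope_def_field, intervalIntegral.integral_same, sub_zero, div_eq_inv_mul, ← neg_mul,
    ← inv_neg, neg_sub]

variable {E ι : Type*} [NormedAddCommGroup E] [InnerProductSpace ℝ E] [MeasurableSpace E]
  [BorelSpace E] {C : Set E} {ν : ι → E} {c : ι → ℝ} {σ : ι → Set E} {x₀ x : E} {I : Set ℝ} {r : ℝ}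

/-- `C` is a bounded open convex set whose boundary is covered by the closed faces `σ a`, where
`σ a` lies in the hyperplane with outer unit normal `ν a` and offset `c a`; distinct faces overlap
in a null set only. -/
structure HasFaces (C : Set E) (ν : ι → E) (c : ι → ℝ) (σ : ι → Set E) : Prop where
  isOpen : IsOpen C
  convex : Convex ℝ C
  nonempty : C.Nonempty
  isBounded : Bornology.IsBounded C
  norm_normal : ∀ a, ‖ν a‖ = 1
  inner_lt : ∀ a, ∀ x ∈ C, inner ℝ (ν a) x < c a
  isClosed : ∀ a, IsClosed (σ a)
  subset : ∀ a, σ a ⊆ hyperplane (ν a) (c a)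
  frontier_eq : frontier C = ⋃ a, σ a
  null : ∀ a b, a ≠ b → surfaceMeasure E (σ a ∩ σ b) = 0

namespace HasFaces

theorem face_subset_frontier (h : HasFaces C ν c σ) (a : ι) : σ a ⊆ frontier C :=
  h.frontier_eq ▸ subset_iUnion σ a

theorem face_subset_closure (h : HasFaces C ν c σ) (a : ι) : σ a ⊆ closure C :=
  (h.face_subset_frontier a).trans frontier_subset_closure

theorem isCompact_face [FiniteDimensional ℝ E] (h : HasFaces C ν c σ) (a : ι) : IsCompact (σ a) :=
  h.isBounded.isCompact_closure.of_isClosed_subset (h.isClosed a) (h.face_subset_closure a)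

theorem normal_ne_zero (h : HasFaces C ν c σ) (a : ι) : ν a ≠ 0 :=
  norm_ne_zero_iff.1 (h.norm_normal a ▸ one_ne_zero)

theorem mem_cone_face_iff (h : HasFaces C ν c σ) (hx₀ : x₀ ∈ C) (hI : I ⊆ Ioi 0) (a : ι) :
    x ∈ cone x₀ (σ a) I ↔ centeredGauge C x₀ x ∈ I ∧
      AffineMap.lineMap x₀ x (centeredGauge C x₀ x)⁻¹ ∈ σ a := by
  constructor
  · rintro ⟨y, hy, t, ht, rfl⟩
    have ht0 : 0 < t := hI ht
    have hgauge : centeredGauge C x₀ y = 1 :=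
      (centeredGauge_eq_one_iff h.isOpen h.convex hx₀).2 (h.face_subset_frontier a hy)
    rw [centeredGauge_lineMap ht0.le, hgauge, mul_one, AffineMap.lineMap_lineMap_right,
      inv_mul_cancel₀ ht0.ne', AffineMap.lineMap_apply_one]
    exact ⟨ht, hy⟩
  · rintro ⟨ht, hy⟩
    exact ⟨_, hy, _, ht, lineMap_lineMap_inv (mem_Ioi.1 (hI ht)).ne'⟩

theorem relHeight_eq_centeredGauge (h : HasFaces C ν c σ) (hx₀ : x₀ ∈ C) (hI : I ⊆ Ioi 0) {a : ι}
    (hx : x ∈ cone x₀ (σ a) I) : relHeight (ν a) (c a) x₀ x = centeredGauge C x₀ x := by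
  obtain ⟨y, hy, t, ht, rfl⟩ := hx
  rw [relHeight_lineMap_of_mem (h.inner_lt a x₀ hx₀).ne (h.subset a hy),
    centeredGauge_lineMap (mem_Ioi.1 (hI ht)).le,
    (centeredGauge_eq_one_iff h.isOpen h.convex hx₀).2 (h.face_subset_frontier a hy), mul_one]

theorem exists_mem_cone_face (h : HasFaces C ν c σ) (hx₀ : x₀ ∈ C) (hI : I ⊆ Ioi 0)
    (hx : centeredGauge C x₀ x ∈ I) : ∃ a, x ∈ cone x₀ (σ a) I := by
  have hpos : 0 < centeredGauge C x₀ x := hI hx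
  have hmem : AffineMap.lineMap x₀ x (centeredGauge C x₀ x)⁻¹ ∈ frontier C := by
    rw [← centeredGauge_eq_one_iff h.isOpen h.convex hx₀,
      centeredGauge_lineMap (inv_nonneg.2 hpos.le), inv_mul_cancel₀ hpos.ne']
  rw [h.frontier_eq] at hmem
  obtain ⟨a, ha⟩ := mem_iUnion.1 hmem
  exact ⟨a, (h.mem_cone_face_iff hx₀ hI a).2 ⟨hx, ha⟩⟩

theorem measurableSet_cone_face [FiniteDimensional ℝ E] (h : HasFaces C ν c σ) (hx₀ : x₀ ∈ C)
    (hIm : MeasurableSet I) (hI : I ⊆ Ioi 0) (a : ι) : MeasurableSet (cone x₀ (σ a) I) :=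
  measurableSet_cone (h.inner_lt a x₀ hx₀).ne (h.subset a) (h.isClosed a).measurableSet hIm hI

theorem ae_eq_of_mem_cone_face [FiniteDimensional ℝ E] [Countable ι] (h : HasFaces C ν c σ)
    (hx₀ : x₀ ∈ C) (hIm : MeasurableSet I) (hI : I ⊆ Ioi 0) :
    ∀ᵐ x : E, ∀ a b, x ∈ cone x₀ (σ a) I → x ∈ cone x₀ (σ b) I → a = b := by
  refine ae_all_iff.2 fun a => ae_all_iff.2 fun b => ?_
  by_cases hab : a = b
  · exact Eventually.of_forall fun _ _ _ => hab
  have hnull : volume (cone x₀ (σ a ∩ σ b) I) = 0 :=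
    volume_cone_of_null (h.norm_normal a) (h.inner_lt a x₀ hx₀)
      ((h.isClosed a).inter (h.isClosed b)).measurableSet
      (inter_subset_left.trans (h.subset a)) hIm hI (h.null a b hab)
  filter_upwards [measure_eq_zero_iff_ae_notMem.1 hnull] with x hx hxa hxb
  obtain ⟨ht, ha⟩ := (h.mem_cone_face_iff hx₀ hI a).1 hxa
  obtain ⟨-, hb⟩ := (h.mem_cone_face_iff hx₀ hI b).1 hxb
  exact absurd ⟨_, ⟨ha, hb⟩, _, ht, lineMap_lineMap_inv (mem_Ioi.1 (hI ht)).ne'⟩ hx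

variable [FiniteDimensional ℝ E]

theorem integrableOn_lineDeriv (h : HasFaces C ν c σ) (v : E) {g : E → ℝ} {L : NNReal}
    (hg : LipschitzWith L g) : IntegrableOn (fun x => lineDeriv ℝ g x v) C :=
  Measure.integrableOn_of_bounded h.isBounded.measure_lt_top.ne
    (aestronglyMeasurable_lineDeriv hg.continuous volume)
    (Eventually.of_forall fun _ => norm_lineDeriv_le_of_lipschitz ℝ hg)

variable [Fintype ι]

theorem lineDeriv_cutoff_ae_eq (h : HasFaces C ν c σ) (hx₀ : x₀ ∈ C) (hr0 : 0 ≤ r) (hr : r < 1)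
    (v : E) (g : E → ℝ) :
    (fun x => lineDeriv ℝ (cutoff C x₀ r) x (-v) * g x) =ᵐ[volume]
      fun x => ∑ a, (cone x₀ (σ a) (Ioo r 1)).indicator
        (fun x => (1 - r)⁻¹ * (inner ℝ (ν a) v / (c a - inner ℝ (ν a) x₀)) * g x) x := by
  have hI : Ioo r 1 ⊆ Ioi 0 := fun t ht => hr0.trans_lt ht.1
  obtain ⟨L, hL⟩ := exists_lipschitzWith_cutoff h.isOpen h.convex hx₀ r
  filter_upwards [hL.ae_differentiableAt (μ := volume),
    h.ae_eq_of_mem_cone_face hx₀ measurableSet_Ioo hI] with x hdiff hunique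
  rw [hdiff.lineDeriv_eq_fderiv]
  by_cases hxr : centeredGauge C x₀ x ∈ Ioo r 1
  · obtain ⟨a, ha⟩ := h.exists_mem_cone_face hx₀ hI hxr
    rw [Finset.sum_eq_single_of_mem a (Finset.mem_univ a) fun b _ hba =>
        indicator_of_notMem (fun hb => hba (hunique b a hb ha)) _,
      indicator_of_mem ha, map_neg, fderiv_cutoff_of_relHeight_eq h.isOpen h.convex hx₀
        (h.inner_lt a) (h.relHeight_eq_centeredGauge hx₀ hI ha) hxr hdiff, neg_neg]
  · rw [fderiv_cutoff_eq_zero hr hxr, Finset.sum_eq_zero fun a _ => indicator_of_notMem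
      (fun ha => hxr ((h.mem_cone_face_iff hx₀ hI a).1 ha).1) _]
    exact zero_mul _

theorem integral_lineDeriv_mul_cutoff (h : HasFaces C ν c σ) (hx₀ : x₀ ∈ C) (hr0 : 0 ≤ r)
    (hr : r < 1) (v : E) {g : E → ℝ} {L : NNReal} (hg : LipschitzWith L g) :
    ∫ x, lineDeriv ℝ g x v * cutoff C x₀ r x =
      (1 - r)⁻¹ * ∫ t in r..1, ∑ a, inner ℝ (ν a) v * scaledFaceIntegral x₀ (σ a) g t := by
  have hI : Ioo r 1 ⊆ Ioi 0 := fun t ht => hr0.trans_lt ht.1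
  have hm := h.measurableSet_cone_face hx₀ measurableSet_Ioo hI
  obtain ⟨L', hL'⟩ := exists_lipschitzWith_cutoff h.isOpen h.convex hx₀ r
  rw [hg.integral_lineDeriv_mul_eq hL'
      (hasCompactSupport_cutoff h.isOpen h.convex h.isBounded hx₀ hr),
    integral_congr_ae (h.lineDeriv_cutoff_ae_eq hx₀ hr0 hr v g),
    integral_finsetSum _ fun a _ => (integrable_indicator_iff (hm a)).2
      ((integrableOn_cone (h.isCompact_face a) hg.continuous).const_mul _),
    intervalIntegral.integral_finsetSum fun a _ => ((continuous_scaledFaceIntegral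
      (h.normal_ne_zero a) (h.isCompact_face a) (h.subset a)
        hg.continuous).const_mul _).intervalIntegrable _ _, Finset.mul_sum]
  refine Finset.sum_congr rfl fun a _ => ?_
  have hheight : c a - inner ℝ (ν a) x₀ ≠ 0 := (sub_pos.2 (h.inner_lt a x₀ hx₀)).ne'
  rw [integral_indicator (hm a), integral_const_mul, intervalIntegral.integral_const_mul,
    setIntegral_cone (h.norm_normal a) (h.inner_lt a x₀ hx₀) (h.isCompact_face a) (h.subset a)
      hr0 hr.le hg.continuous]
  field_simp

theorem integral_lineDeriv (h : HasFaces C ν c σ) (v : E) {g : E → ℝ} {L : NNReal}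
    (hg : LipschitzWith L g) :
    ∫ x in C, lineDeriv ℝ g x v =
      ∑ a, inner ℝ (ν a) v * ∫ y in σ a, g y ∂surfaceMeasure E := by
  obtain ⟨x₀, hx₀⟩ := h.nonempty
  set A : ℝ → ℝ := fun t => ∑ a, inner ℝ (ν a) v * scaledFaceIntegral x₀ (σ a) g t with hA
  have hAc : Continuous A := continuous_finsetSum _ fun a _ => (continuous_scaledFaceIntegral
    (h.normal_ne_zero a) (h.isCompact_face a) (h.subset a) hg.continuous).const_mul _
  have hA1 : A 1 = ∑ a, inner ℝ (ν a) v * ∫ y in σ a, g y ∂surfaceMeasure E := by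
    simp only [hA, scaledFaceIntegral_one]
  rw [← hA1]
  refine tendsto_nhds_unique (tendsto_setIntegral_mul_cutoff h.isOpen h.convex hx₀
    (h.integrableOn_lineDeriv v hg)) ((tendsto_inv_mul_intervalIntegral hAc 1).congr' ?_)
  filter_upwards [Ioo_mem_nhdsLT (zero_lt_one' ℝ)] with r hr
  rw [← h.integral_lineDeriv_mul_cutoff hx₀ hr.1.le hr.2 v hg]
  refine (setIntegral_eq_integral_of_forall_compl_eq_zero fun x hx => ?_).symm
  rw [cutoff_eq_zero_of_notMem h.isOpen h.convex hx₀ hr.2 hx, mul_zero]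

end HasFaces

section Divergence

variable {C : Set (Sp d)} {ν : ι → Sp d} {σ : ι → Set (Sp d)}

theorem surfaceMeasure_euclideanSpace : surfaceMeasure (Sp d) = surf d := by
  rw [surfaceMeasure, finrank_euclideanSpace_fin]

theorem HasFaces.integral_lineDeriv_of_lipschitzOnWith [Fintype ι] (h : HasFaces C ν c σ)
    (v : Sp d) {g : Sp d → ℝ} {L : NNReal} (hg : LipschitzOnWith L g (closure C)) :
    IntegrableOn (fun x => lineDeriv ℝ g x v) C ∧
    ∫ x in C, lineDeriv ℝ g x v = ∑ a, ∫ y in σ a, inner ℝ (ν a) v * g y ∂surf d := by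
  obtain ⟨g', hg', hgg'⟩ := hg.extend_real
  have hderiv : ∀ x ∈ C, lineDeriv ℝ g x v = lineDeriv ℝ g' x v := fun x hx =>
    Filter.EventuallyEq.lineDeriv_eq <| by
      filter_upwards [h.isOpen.mem_nhds hx] with z hz using hgg' (subset_closure hz)
  refine ⟨(integrableOn_congr_fun hderiv h.isOpen.measurableSet).2
    (h.integrableOn_lineDeriv v hg'), ?_⟩
  rw [setIntegral_congr_fun h.isOpen.measurableSet hderiv, h.integral_lineDeriv v hg',
    surfaceMeasure_euclideanSpace]
  refine Finset.sum_congr rfl fun a _ => ?_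
  rw [integral_const_mul, setIntegral_congr_fun (h.isClosed a).measurableSet fun y hy =>
    (hgg' (h.face_subset_closure a hy)).symm]

theorem divergence_eq_sum_lineDeriv {F : Sp d → Sp d} {x : Sp d} (hF : DifferentiableAt ℝ F x) :
    divergence F x = ∑ k, lineDeriv ℝ (fun z => F z k) x (EuclideanSpace.single k 1) :=
  Finset.sum_congr rfl fun k _ => (((EuclideanSpace.proj k : Sp d →L[ℝ] ℝ).hasFDerivAt.comp x
    hF.hasFDerivAt).hasLineDerivAt _).lineDeriv.symm

theorem HasFaces.integral_divergence [Fintype ι] (h : HasFaces C ν c σ) {F : Sp d → Sp d}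
    {L : NNReal} (hF : LipschitzOnWith L F (closure C)) (hdiff : DifferentiableOn ℝ F C) :
    ∫ x in C, divergence F x = ∑ a, ∫ y in σ a, inner ℝ (F y) (ν a) ∂surf d := by
  have hcomp (k : Fin d) : LipschitzOnWith (‖(EuclideanSpace.proj k : Sp d →L[ℝ] ℝ)‖₊ * L)
      (fun x => F x k) (closure C) :=
    (EuclideanSpace.proj k : Sp d →L[ℝ] ℝ).lipschitz.comp_lipschitzOnWith hF
  have hgauss k := h.integral_lineDeriv_of_lipschitzOnWith (EuclideanSpace.single k 1) (hcomp k)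
  rw [setIntegral_congr_fun h.isOpen.measurableSet fun x hx =>
      divergence_eq_sum_lineDeriv (hdiff.differentiableAt (h.isOpen.mem_nhds hx)),
    integral_finsetSum _ fun k _ => (hgauss k).1]
  simp only [fun k => (hgauss k).2]
  rw [Finset.sum_comm]
  refine Finset.sum_congr rfl fun a _ => ?_
  have hint (k : Fin d) : Integrable (fun y => inner ℝ (ν a) (EuclideanSpace.single k 1) * F y k)
      ((surf d).restrict (σ a)) := by
    rw [← surfaceMeasure_euclideanSpace]
    exact integrableOn_surfaceMeasure (h.normal_ne_zero a) (h.isCompact_face a) (h.subset a)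
      (continuousOn_const.mul ((hcomp k).continuousOn.mono (h.face_subset_closure a)))
  rw [← integral_finsetSum _ fun k _ => hint k]
  simp [PiLp.inner_apply]

end Divergence

end Gauss

section Hoffman

variable {ι : Type*} [Fintype ι] {F : Type*} [NormedAddCommGroup F] [NormedSpace ℝ F]

theorem exists_pos_mul_sum_le_norm_of_support_subset (A : (ι → ℝ) →ₗ[ℝ] F) {J : Set ι}
    (hJ : ∀ τ ∈ stdSimplex ℝ ι, Function.support τ ⊆ J → A τ ≠ 0) :
    ∃ c > 0, ∀ ρ : ι → ℝ, 0 ≤ ρ → Function.support ρ ⊆ J → c * ∑ k, ρ k ≤ ‖A ρ‖ := by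
  have hA : Continuous A := A.continuous_of_finiteDimensional
  have hcpt : IsCompact (stdSimplex ℝ ι ∩ {τ | Function.support τ ⊆ J}) := by
    refine (isCompact_stdSimplex ℝ ι).inter_right ?_
    simp only [Function.support_subset_iff', ofPred_forall]
    exact isClosed_iInter fun k => isClosed_iInter fun _ =>
      isClosed_eq (continuous_apply k) continuous_const
  obtain ⟨c, hc, hcA⟩ : ∃ c > 0, ∀ τ ∈ stdSimplex ℝ ι ∩ {τ | Function.support τ ⊆ J}, c ≤ ‖A τ‖ :=
    hcpt.exists_forall_le' hA.norm.continuousOn fun τ hτ => norm_pos_iff.2 (hJ τ hτ.1 hτ.2)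
  refine ⟨c, hc, fun ρ hρ hρJ => ?_⟩
  rcases (Finset.sum_nonneg fun k _ => hρ k).eq_or_lt with h | h
  · rw [← h, mul_zero]
    exact norm_nonneg _
  · have hmem : (∑ k, ρ k)⁻¹ • ρ ∈ stdSimplex ℝ ι := by
      refine ⟨fun k => mul_nonneg (inv_nonneg.2 h.le) (hρ k), ?_⟩
      simp only [Pi.smul_apply, smul_eq_mul, ← Finset.mul_sum]
      exact inv_mul_cancel₀ h.ne'
    have hle := hcA _ ⟨hmem, (Function.support_const_smul_subset _ ρ).trans hρJ⟩
    rwa [map_smul, norm_smul, norm_inv, Real.norm_of_nonneg h.le, inv_mul_eq_div,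
      le_div_iff₀ h] at hle

theorem exists_pos_mul_sum_le_norm (A : (ι → ℝ) →ₗ[ℝ] F) :
    ∃ c > 0, ∀ ρ : ι → ℝ, 0 ≤ ρ →
      (∀ τ ∈ stdSimplex ℝ ι, Function.support τ ⊆ Function.support ρ → A τ ≠ 0) →
      c * ∑ k, ρ k ≤ ‖A ρ‖ := by
  have hev : ∀ J : Set ι, ∀ᶠ c : ℝ in 𝓝[>] 0,
      (∀ τ ∈ stdSimplex ℝ ι, Function.support τ ⊆ J → A τ ≠ 0) →
      ∀ ρ : ι → ℝ, 0 ≤ ρ → Function.support ρ ⊆ J → c * ∑ k, ρ k ≤ ‖A ρ‖ := by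
    intro J
    by_cases hJ : ∀ τ ∈ stdSimplex ℝ ι, Function.support τ ⊆ J → A τ ≠ 0
    · obtain ⟨c, hc, hcA⟩ := exists_pos_mul_sum_le_norm_of_support_subset A hJ
      filter_upwards [Ioo_mem_nhdsGT hc] with c' hc' _ ρ hρ hρJ
      exact (mul_le_mul_of_nonneg_right hc'.2.le (Finset.sum_nonneg fun k _ => hρ k)).trans
        (hcA ρ hρ hρJ)
    · exact Eventually.of_forall fun c h => absurd h hJ
  obtain ⟨c, hcA, hc⟩ := ((eventually_all.2 hev).and self_mem_nhdsWithin).exists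
  exact ⟨c, hc, fun ρ hρ h => hcA _ h ρ hρ subset_rfl⟩

theorem exists_maximal_le_map_eq_zero (A : (ι → ℝ) →ₗ[ℝ] F) {l : ι → ℝ} (hl : 0 ≤ l) :
    ∃ μ, 0 ≤ μ ∧ μ ≤ l ∧ A μ = 0 ∧
      ∀ τ ∈ stdSimplex ℝ ι, Function.support τ ⊆ Function.support (l - μ) → A τ ≠ 0 := by
  have hcpt : IsCompact (Icc 0 l ∩ {μ | A μ = 0}) :=
    isCompact_Icc.inter_right
      (isClosed_eq A.continuous_of_finiteDimensional continuous_const)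
  obtain ⟨μ, ⟨⟨hμ, hμl⟩, hμA⟩, hmax⟩ := hcpt.exists_isMaxOn ⟨0, ⟨le_rfl, hl⟩, map_zero A⟩
    (f := fun μ : ι → ℝ => ∑ k, μ k) (by fun_prop)
  refine ⟨μ, hμ, hμl, hμA, fun τ hτ hsupp hτA => ?_⟩
  have hev : ∀ k, ∀ᶠ s : ℝ in 𝓝[>] 0, μ k + s * τ k ≤ l k := by
    intro k
    rcases (hμl k).eq_or_lt with h | h
    · have hτk : τ k = 0 := Function.notMem_support.1 fun hk => hsupp hk (by simp [h])
      exact Eventually.of_forall fun s => by rw [hτk, mul_zero, add_zero, h]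
    · have hlim : Tendsto (fun s : ℝ => μ k + s * τ k) (𝓝 0) (𝓝 (μ k + 0 * τ k)) :=
        Continuous.tendsto (by fun_prop) 0
      rw [zero_mul, add_zero] at hlim
      exact ((hlim.eventually_lt_const h).mono fun s => le_of_lt).filter_mono nhdsWithin_le_nhds
  obtain ⟨s, hsl, hs⟩ := ((eventually_all.2 hev).and self_mem_nhdsWithin).exists
  have hle : ∑ k, (μ + s • τ) k ≤ ∑ k, μ k := by
    refine hmax ⟨⟨add_nonneg hμ (smul_nonneg hs.le hτ.1), hsl⟩, ?_⟩
    rw [mem_ofPred_eq, map_add, map_smul, hμA, hτA, smul_zero, add_zero]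
  simp only [Pi.add_apply, Pi.smul_apply, smul_eq_mul, Finset.sum_add_distrib, ← Finset.mul_sum,
    hτ.2] at hle
  linarith

/- What is left of `l` after a maximal part in the kernel is removed has a support that carries no
element of the kernel, so that its mass is controlled by `‖A l‖`. -/
theorem exists_mem_stdSimplex_map_eq_zero_norm_sub_le (A : (ι → ℝ) →ₗ[ℝ] F) {μ₀ : ι → ℝ}
    (hμ₀ : μ₀ ∈ stdSimplex ℝ ι) (hA : A μ₀ = 0) :
    ∃ C, ∀ l ∈ stdSimplex ℝ ι, ∃ μ ∈ stdSimplex ℝ ι, A μ = 0 ∧ ‖l - μ‖ ≤ C * ‖A l‖ := by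
  obtain ⟨c, hc, hcA⟩ := exists_pos_mul_sum_le_norm A
  refine ⟨2 / c, fun l hl => ?_⟩
  obtain ⟨μ, hμ, hμl, hμA, hmax⟩ := exists_maximal_le_map_eq_zero A hl.1
  have hsub : ∀ k, 0 ≤ (l - μ) k := fun k => sub_nonneg.2 (hμl k)
  set R := ∑ k, (l - μ) k with hR
  have hR0 : 0 ≤ R := Finset.sum_nonneg fun k _ => hsub k
  have hbound : c * R ≤ ‖A l‖ := by
    have h := hcA (l - μ) hsub hmax
    rwa [map_sub, hμA, sub_zero] at h
  refine ⟨μ + R • μ₀, ⟨add_nonneg hμ (smul_nonneg hR0 hμ₀.1), ?_⟩, ?_, ?_⟩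
  · simp only [Pi.add_apply, Pi.smul_apply, smul_eq_mul, Finset.sum_add_distrib, ← Finset.mul_sum,
      hμ₀.2, hR, Pi.sub_apply, Finset.sum_sub_distrib, hl.2]
    ring
  · rw [map_add, map_smul, hμA, hA, smul_zero, add_zero]
  · have hnorm : ‖l - μ‖ ≤ R := (pi_norm_le_iff_of_nonneg hR0).2 fun k => by
      rw [Real.norm_of_nonneg (hsub k)]
      exact Finset.single_le_sum (fun i _ => hsub i) (Finset.mem_univ k)
    have hμ₀1 : ‖μ₀‖ ≤ 1 := by simpa using stdSimplex_subset_closedBall hμ₀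
    calc ‖l - (μ + R • μ₀)‖ ≤ ‖l - μ‖ + ‖R • μ₀‖ := by rw [← sub_sub]; exact norm_sub_le _ _
      _ ≤ R + R * 1 := by rw [norm_smul, Real.norm_of_nonneg hR0]; gcongr
      _ = 2 / c * (c * R) := by field_simp; ring
      _ ≤ 2 / c * ‖A l‖ := by gcongr

end Hoffman

section LinearRegularity

variable {E : Type*} [NormedAddCommGroup E] [NormedSpace ℝ E] {F : Type*} [NormedAddCommGroup F]
  [NormedSpace ℝ F]

theorem exists_mem_convexHull_map_eq_zero_norm_sub_le {P : Set E} (hP : P.Finite) (f : E →ₗ[ℝ] F)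
    {z : E} (hz : z ∈ convexHull ℝ P) (hfz : f z = 0) :
    ∃ C, ∀ x ∈ convexHull ℝ P, ∃ y ∈ convexHull ℝ P, f y = 0 ∧ ‖x - y‖ ≤ C * ‖f x‖ := by
  let := hP.fintype
  obtain ⟨g, hg⟩ : ∃ g : (P → ℝ) →ₗ[ℝ] E, convexHull ℝ P = g '' stdSimplex ℝ P :=
    ⟨_, hP.convexHull_eq_image⟩
  rw [hg] at hz ⊢
  obtain ⟨μ₀, hμ₀, rfl⟩ := hz
  obtain ⟨C, hC⟩ := exists_mem_stdSimplex_map_eq_zero_norm_sub_le (f ∘ₗ g) hμ₀ hfz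
  refine ⟨‖LinearMap.toContinuousLinearMap g‖ * C, ?_⟩
  rintro _ ⟨l, hl, rfl⟩
  obtain ⟨μ, hμ, hfμ, hle⟩ := hC l hl
  refine ⟨g μ, mem_image_of_mem g hμ, hfμ, ?_⟩
  rw [← map_sub, mul_assoc]
  exact ((LinearMap.toContinuousLinearMap g).le_opNorm _).trans
    (mul_le_mul_of_nonneg_left hle (norm_nonneg _))

theorem exists_mem_inter_convexHull_dist_le {P Q : Set E} (hP : P.Finite) (hQ : Q.Finite)
    (hPQ : (convexHull ℝ P ∩ convexHull ℝ Q).Nonempty) :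
    ∃ C, ∀ x ∈ convexHull ℝ P, ∀ y ∈ convexHull ℝ Q,
      ∃ z ∈ convexHull ℝ P ∩ convexHull ℝ Q, dist x z ≤ C * dist x y := by
  obtain ⟨z₀, hz₀⟩ := hPQ
  have h := exists_mem_convexHull_map_eq_zero_norm_sub_le (hP.prod hQ)
    (LinearMap.fst ℝ E E - LinearMap.snd ℝ E E) (z := (z₀, z₀))
  rw [convexHull_prod] at h
  obtain ⟨C, hC⟩ := h hz₀ (sub_self z₀)
  refine ⟨C, fun x hx y hy => ?_⟩
  obtain ⟨⟨z, w⟩, hzw, heq, hle⟩ := hC (x, y) ⟨hx, hy⟩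
  obtain rfl : z = w := sub_eq_zero.1 heq
  refine ⟨z, hzw, ?_⟩
  rw [dist_eq_norm, dist_eq_norm]
  exact (norm_fst_le ((x, y) - (z, z))).trans hle

end LinearRegularity

section Lipschitz

open scoped NNReal

theorem exists_lipschitzOnWith_union_of_disjoint {X Y : Type*} [MetricSpace X] [PseudoMetricSpace Y]
    {f : X → Y} {A B : Set X} (hA : IsCompact A) (hB : IsCompact B) (hAB : Disjoint A B)
    {L₁ L₂ : ℝ≥0} (hfA : LipschitzOnWith L₁ f A) (hfB : LipschitzOnWith L₂ f B) :
    ∃ L, LipschitzOnWith L f (A ∪ B) := by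
  refine LocallyLipschitzOn.exists_lipschitzOnWith_of_compact (hA.union hB) ?_
  have hmem : ∀ {A B : Set X}, IsClosed B → Disjoint A B → ∀ x ∈ A, A ∈ 𝓝[A ∪ B] x := by
    intro A B hB hAB x hx
    filter_upwards [inter_mem_nhdsWithin (A ∪ B)
      (hB.isOpen_compl.mem_nhds (hAB.subset_compl_right hx))] with y hy
    exact hy.1.resolve_right hy.2
  rintro x (hx | hx)
  · exact ⟨L₁, A, hmem hB.isClosed hAB x hx, hfA⟩
  · exact ⟨L₂, B, union_comm B A ▸ hmem hA.isClosed hAB.symm x hx, hfB⟩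

theorem lipschitzOnWith_union_of_dist_le {X Y : Type*} [PseudoMetricSpace X] [PseudoMetricSpace Y]
    {f : X → Y} {A B : Set X} {L₁ L₂ C : ℝ≥0} (hfA : LipschitzOnWith L₁ f A)
    (hfB : LipschitzOnWith L₂ f B)
    (hAB : ∀ x ∈ A, ∀ y ∈ B, ∃ z ∈ A ∩ B, dist x z ≤ C * dist x y) :
    LipschitzOnWith (max (max L₁ L₂) (L₁ * C + L₂ * (C + 1))) f (A ∪ B) := by
  have hcross : ∀ x ∈ A, ∀ y ∈ B, dist (f x) (f y) ≤ ↑(L₁ * C + L₂ * (C + 1)) * dist x y := by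
    intro x hx y hy
    obtain ⟨z, hz, hxz⟩ := hAB x hx y hy
    have hzy : dist z y ≤ (C + 1) * dist x y := by
      linarith [dist_triangle_left z y x]
    calc dist (f x) (f y) ≤ dist (f x) (f z) + dist (f z) (f y) := dist_triangle _ _ _
      _ ≤ L₁ * dist x z + L₂ * dist z y :=
        add_le_add (hfA.dist_le_mul x hx z hz.1) (hfB.dist_le_mul z hz.2 y hy)
      _ ≤ L₁ * (C * dist x y) + L₂ * ((C + 1) * dist x y) := by gcongr
      _ = _ := by push_cast; ring
  have hweaken : ∀ {K K' : ℝ≥0} {x y : X}, K ≤ K' → dist (f x) (f y) ≤ K * dist x y →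
      dist (f x) (f y) ≤ K' * dist x y := fun hK h =>
    h.trans (mul_le_mul_of_nonneg_right (NNReal.coe_le_coe.2 hK) dist_nonneg)
  refine LipschitzOnWith.of_dist_le_mul ?_
  rintro x (hx | hx) y (hy | hy)
  · exact hweaken ((le_max_left _ _).trans (le_max_left _ _)) (hfA.dist_le_mul x hx y hy)
  · exact hweaken (le_max_right _ _) (hcross x hx y hy)
  · rw [dist_comm, dist_comm x]
    exact hweaken (le_max_right _ _) (hcross y hy x hx)
  · exact hweaken ((le_max_right _ _).trans (le_max_left _ _)) (hfB.dist_le_mul x hx y hy)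

theorem exists_lipschitzOnWith_biUnion {ι X Y : Type*} [PseudoMetricSpace X] [PseudoMetricSpace Y]
    {P : Set ι} (hP : P.Finite) {f : X → Y} {A : ι → Set X}
    (h : ∀ s ∈ P, ∀ t ∈ P, ∃ L, LipschitzOnWith L f (A s ∪ A t)) :
    ∃ L, LipschitzOnWith L f (⋃ s ∈ P, A s) := by
  have hev : ∀ᶠ L in atTop, ∀ s ∈ P, ∀ t ∈ P, LipschitzOnWith L f (A s ∪ A t) :=
    hP.eventually_all.2 fun s hs => hP.eventually_all.2 fun t ht => by
      obtain ⟨L, hL⟩ := h s hs t ht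
      filter_upwards [eventually_ge_atTop L] with L' hL'
      exact hL.weaken hL'
  obtain ⟨L, hL⟩ := hev.exists
  refine ⟨L, fun x hx y hy => ?_⟩
  obtain ⟨s, hs, hxs⟩ := mem_iUnion₂.1 hx
  obtain ⟨t, ht, hyt⟩ := mem_iUnion₂.1 hy
  exact hL s hs t ht (Or.inl hxs) (Or.inr hyt)

variable {E : Type*} [NormedAddCommGroup E] [NormedSpace ℝ E]

theorem exists_lipschitzOnWith_union_convexHull {Y : Type*} [PseudoMetricSpace Y] {f : E → Y}
    {P Q : Set E} (hP : P.Finite) (hQ : Q.Finite) {L₁ L₂ : ℝ≥0}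
    (hfP : LipschitzOnWith L₁ f (convexHull ℝ P)) (hfQ : LipschitzOnWith L₂ f (convexHull ℝ Q)) :
    ∃ L, LipschitzOnWith L f (convexHull ℝ P ∪ convexHull ℝ Q) := by
  rcases (convexHull ℝ P ∩ convexHull ℝ Q).eq_empty_or_nonempty with h | h
  · exact exists_lipschitzOnWith_union_of_disjoint (hP.isCompact_convexHull ℝ)
      (hQ.isCompact_convexHull ℝ) (disjoint_iff_inter_eq_empty.2 h) hfP hfQ
  · obtain ⟨C, hC⟩ := exists_mem_inter_convexHull_dist_le hP hQ h
    refine ⟨_, lipschitzOnWith_union_of_dist_le (C := C.toNNReal) hfP hfQ fun x hx y hy => ?_⟩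
    obtain ⟨z, hz, hxz⟩ := hC x hx y hy
    exact ⟨z, hz, hxz.trans (mul_le_mul_of_nonneg_right (Real.le_coe_toNNReal C) dist_nonneg)⟩

theorem exists_lipschitzOnWith_of_contDiffOn {F : Type*} [NormedAddCommGroup F] [NormedSpace ℝ F]
    {f : E → F} {K : Set E} (hf : ContDiffOn ℝ 1 f K) (hK : IsCompact K) (hc : Convex ℝ K) :
    ∃ L, LipschitzOnWith L f K :=
  LocallyLipschitzOn.exists_lipschitzOnWith_of_compact hK fun x hx =>
    let ⟨L, t, ht, hL⟩ := (hf x hx).exists_lipschitzOnWith hc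
    ⟨L, t, ht, hL⟩

end Lipschitz

theorem IsPolygonalDomain.isCompact_closure {Ω : Set (Sp d)} (hΩ : IsPolygonalDomain Ω) :
    IsCompact (closure Ω) := by
  obtain ⟨P, hP, h⟩ := hΩ.polytopes
  rw [h]
  exact hP.isCompact_biUnion fun s _ => s.finite_toSet.isCompact_convexHull ℝ

theorem IsPolygonalDomain.isBounded {Ω : Set (Sp d)} (hΩ : IsPolygonalDomain Ω) :
    Bornology.IsBounded Ω :=
  hΩ.isCompact_closure.isBounded.subset subset_closure

theorem IsPolygonalDomain.dist_le_diam {Ω : Set (Sp d)} (hΩ : IsPolygonalDomain Ω) {x y : Sp d}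
    (hx : x ∈ closure Ω) (hy : y ∈ closure Ω) : dist x y ≤ Metric.diam Ω := by
  rw [← Metric.diam_closure]
  exact Metric.dist_le_diam_of_mem hΩ.isCompact_closure.isBounded hx hy

theorem IsPolygonalDomain.exists_lipschitzOnWith {F : Type*} [NormedAddCommGroup F]
    [NormedSpace ℝ F] {Ω : Set (Sp d)} (hΩ : IsPolygonalDomain Ω) {f : Sp d → F}
    (hf : ContDiffOn ℝ 1 f (closure Ω)) : ∃ L, LipschitzOnWith L f (closure Ω) := by
  obtain ⟨P, hP, h⟩ := hΩ.polytopes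
  rw [h] at hf ⊢
  have hf' : ∀ s ∈ P, ∃ L, LipschitzOnWith L f (convexHull ℝ (s : Set (Sp d))) := fun s hs =>
    exists_lipschitzOnWith_of_contDiffOn
      (hf.mono (subset_iUnion₂_of_subset s hs subset_rfl))
      (s.finite_toSet.isCompact_convexHull ℝ) (convex_convexHull ℝ _)
  refine exists_lipschitzOnWith_biUnion hP fun s hs t ht => ?_
  obtain ⟨L₁, hL₁⟩ := hf' s hs
  obtain ⟨L₂, hL₂⟩ := hf' t ht
  exact exists_lipschitzOnWith_union_convexHull s.finite_toSet t.finite_toSet hL₁ hL₂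

namespace Mesh

variable {T : Mesh d} {Ω : Set (Sp d)} {i j k : Fin T.N} {x y z : Sp d}

theorem face_comm (T : Mesh d) (i j : Fin T.N) : T.face i j = T.face j i := inter_comm _ _

theorem hh_comm (T : Mesh d) (i j : Fin T.N) : T.hh i j = T.hh j i := dist_comm _ _

theorem m_comm (T : Mesh d) (i j : Fin T.N) : T.m i j = T.m j i := by rw [m, m, face_comm]

theorem kap_comm (T : Mesh d) (κ : Sp d → ℝ) (i j : Fin T.N) : T.kap κ i j = T.kap κ j i := by
  rw [kap, kap, hh_comm, mul_comm (T.kbar κ i) (T.kbar κ j), add_comm]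

theorem Adj.symm (h : T.Adj i j) : T.Adj j i :=
  ⟨h.1.symm, by rw [face_comm]; exact h.2⟩

theorem mem_nbrs : j ∈ T.nbrs i ↔ T.Adj i j := by simp [nbrs]

theorem isClosed_face (T : Mesh d) (i j : Fin T.N) : IsClosed (T.face i j) :=
  isClosed_frontier.inter isClosed_frontier

theorem isClosed_bface (T : Mesh d) (Ω : Set (Sp d)) (i : Fin T.N) (y : Sp d) :
    IsClosed (T.bface Ω i y) :=
  (isClosed_frontier.inter isClosed_frontier).inter (isClosed_eq (by fun_prop) continuous_const)

theorem face_subset_closure (T : Mesh d) (i j : Fin T.N) : T.face i j ⊆ closure (T.cell i) :=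
  inter_subset_left.trans frontier_subset_closure

theorem face_subset_closure_inter (T : Mesh d) (i j : Fin T.N) :
    T.face i j ⊆ closure (T.cell i) ∩ closure (T.cell j) :=
  inter_subset_inter frontier_subset_closure frontier_subset_closure

theorem bface_subset_closure (T : Mesh d) (Ω : Set (Sp d)) (i : Fin T.N) (y : Sp d) :
    T.bface Ω i y ⊆ closure (T.cell i) := fun _ hx => frontier_subset_closure hx.1.1

theorem bface_subset_hyperplane (T : Mesh d) (Ω : Set (Sp d)) (i : Fin T.N) (y : Sp d) :
    T.bface Ω i y ⊆ hyperplane (direction (T.node i) y)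
      (inner ℝ (direction (T.node i) y) (T.node i) + T.bh i y) := by
  rintro q ⟨-, hq⟩
  rw [mem_hyperplane, bh, ← inner_direction_right]
  exact inner_direction_eq_of_inner_sub_eq_zero (by rw [real_inner_comm]; exact hq)

namespace IsAdmissible

theorem isOpen_cell (hT : T.IsAdmissible Ω) (i : Fin T.N) : IsOpen (T.cell i) := by
  obtain ⟨s, hs⟩ := hT.polytope i
  exact hs ▸ isOpen_interior

theorem convex_cell (hT : T.IsAdmissible Ω) (i : Fin T.N) : Convex ℝ (T.cell i) := by
  obtain ⟨s, hs⟩ := hT.polytope i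
  exact hs ▸ (convex_convexHull ℝ _).interior

theorem isBounded_cell (hT : T.IsAdmissible Ω) (i : Fin T.N) : Bornology.IsBounded (T.cell i) := by
  obtain ⟨s, hs⟩ := hT.polytope i
  exact hs ▸ (s.finite_toSet.isCompact_convexHull ℝ).isBounded.subset interior_subset

theorem closure_cell_subset (hT : T.IsAdmissible Ω) (i : Fin T.N) :
    closure (T.cell i) ⊆ closure Ω :=
  hT.cover ▸ subset_iUnion (fun i => closure (T.cell i)) i

theorem node_mem_closure (hT : T.IsAdmissible Ω) (i : Fin T.N) : T.node i ∈ closure Ω :=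
  hT.closure_cell_subset i (hT.node_mem i)

theorem cell_subset (hΩ : IsPolygonalDomain Ω) (hT : T.IsAdmissible Ω) (i : Fin T.N) :
    T.cell i ⊆ Ω := by
  rw [← hΩ.interior_closure]
  exact interior_maximal (subset_closure.trans (hT.closure_cell_subset i)) (hT.isOpen_cell i)

theorem isCompact_face (hT : T.IsAdmissible Ω) (i j : Fin T.N) : IsCompact (T.face i j) :=
  (hT.isBounded_cell i).isCompact_closure.of_isClosed_subset (T.isClosed_face i j)
    (T.face_subset_closure i j)

theorem isCompact_bface (hT : T.IsAdmissible Ω) (i : Fin T.N) (y : Sp d) :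
    IsCompact (T.bface Ω i y) :=
  (hT.isBounded_cell i).isCompact_closure.of_isClosed_subset (T.isClosed_bface Ω i y)
    (T.bface_subset_closure Ω i y)

theorem node_ne (hT : T.IsAdmissible Ω) (h : T.Adj i j) : T.node i ≠ T.node j :=
  hT.node_injective.ne h.1

theorem node_ne_of_mem_bnode (hT : T.IsAdmissible Ω) (h : y ∈ T.bnode i) : T.node i ≠ y :=
  fun he => hT.node_notMem i y h (he ▸ hT.bnode_mem i y h)

theorem hh_pos (hT : T.IsAdmissible Ω) (h : T.Adj i j) : 0 < T.hh i j :=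
  dist_pos.2 (hT.node_ne h)

theorem bh_pos (hT : T.IsAdmissible Ω) (h : y ∈ T.bnode i) : 0 < T.bh i y :=
  dist_pos.2 (hT.node_ne_of_mem_bnode h)

theorem exists_face_subset_hyperplane_separating (hT : T.IsAdmissible Ω) (h : T.Adj i j) :
    ∃ c, T.face i j ⊆ hyperplane (direction (T.node i) (T.node j)) c ∧
      (∀ x ∈ T.cell i, inner ℝ (direction (T.node i) (T.node j)) x < c) ∧
      ∀ x ∈ T.cell j, c < inner ℝ (direction (T.node i) (T.node j)) x := by
  obtain ⟨p, hp⟩ := nonempty_of_measure_ne_zero h.2.ne'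
  set ν := direction (T.node i) (T.node j)
  have hsub : T.face i j ⊆ hyperplane ν (inner ℝ ν p) := fun q hq =>
    inner_direction_eq_of_inner_sub_eq_zero (hT.orthogonal i j h q hq p hp)
  have hpos : 0 < surfaceMeasure (Sp d)
      (closure (T.cell i) ∩ closure (T.cell j) ∩ hyperplane ν (inner ℝ ν p)) := by
    rw [surfaceMeasure_euclideanSpace]
    exact h.2.trans_le (measure_mono (subset_inter (T.face_subset_closure_inter i j) hsub))
  refine ⟨inner ℝ ν p, hsub, (opposite_sides (hT.isOpen_cell i) (hT.isOpen_cell j)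
    (hT.convex_cell i) (hT.convex_cell j) (hT.disjoint i j h.1)
    (direction_ne_zero (hT.node_ne h)) hpos).resolve_right fun ⟨hi, hj⟩ => ?_⟩
  have hνj : inner ℝ ν (T.node j) = inner ℝ ν (T.node i) + T.hh i j := inner_direction_right _ _
  linarith [le_inner_of_mem_closure hi (hT.node_mem i),
    inner_le_of_mem_closure hj (hT.node_mem j), hT.hh_pos h]

theorem eq_inner_node_add_dist1 (hT : T.IsAdmissible Ω) (h : T.Adj i j) {ν : Sp d} (hν : ‖ν‖ = 1)
    {c : ℝ} (hsub : T.face i j ⊆ hyperplane ν c) (hlt : ∀ x ∈ T.cell i, inner ℝ ν x < c) :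
    c = inner ℝ ν (T.node i) + T.dist1 i j := by
  have hspan : (affineSpan ℝ (T.face i j) : Set (Sp d)) = hyperplane ν c := by
    refine affineSpan_eq_hyperplane (norm_ne_zero_iff.1 (hν ▸ one_ne_zero)) hsub ?_
    rw [surfaceMeasure_euclideanSpace]
    exact h.2
  rw [dist1, hspan, infDist_hyperplane hν, abs_of_nonneg, add_sub_cancel]
  exact sub_nonneg.2 (inner_le_of_mem_closure hlt (hT.node_mem i))

theorem face_subset_hyperplane (hT : T.IsAdmissible Ω) (h : T.Adj i j) :
    T.face i j ⊆ hyperplane (direction (T.node i) (T.node j))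
      (inner ℝ (direction (T.node i) (T.node j)) (T.node i) + T.dist1 i j) := by
  obtain ⟨c, hsub, hi, -⟩ := hT.exists_face_subset_hyperplane_separating h
  rwa [← hT.eq_inner_node_add_dist1 h (norm_direction (hT.node_ne h)) hsub hi]

theorem inner_direction_lt (hT : T.IsAdmissible Ω) (h : T.Adj i j) (hx : x ∈ T.cell i) :
    inner ℝ (direction (T.node i) (T.node j)) x <
      inner ℝ (direction (T.node i) (T.node j)) (T.node i) + T.dist1 i j := by
  obtain ⟨c, hsub, hi, -⟩ := hT.exists_face_subset_hyperplane_separating h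
  rw [← hT.eq_inner_node_add_dist1 h (norm_direction (hT.node_ne h)) hsub hi]
  exact hi x hx

theorem lt_inner_direction (hT : T.IsAdmissible Ω) (h : T.Adj i j) (hx : x ∈ T.cell j) :
    inner ℝ (direction (T.node i) (T.node j)) (T.node i) + T.dist1 i j <
      inner ℝ (direction (T.node i) (T.node j)) x := by
  obtain ⟨c, hsub, hi, hj⟩ := hT.exists_face_subset_hyperplane_separating h
  rw [← hT.eq_inner_node_add_dist1 h (norm_direction (hT.node_ne h)) hsub hi]
  exact hj x hx

theorem dist1_add (hT : T.IsAdmissible Ω) (h : T.Adj i j) :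
    T.dist1 i j + T.dist1 j i = T.hh i j := by
  obtain ⟨c, hsub, hi, hj⟩ := hT.exists_face_subset_hyperplane_separating h
  have hν := norm_direction (hT.node_ne h)
  have hci := hT.eq_inner_node_add_dist1 h hν hsub hi
  have hcj := hT.eq_inner_node_add_dist1 (c := -c) h.symm ((norm_neg _).trans hν)
    (by rwa [face_comm, hyperplane_neg])
    fun x hx => by rw [inner_neg_left]; exact neg_lt_neg (hj x hx)
  have hij := inner_direction_right (T.node i) (T.node j)
  rw [inner_neg_left] at hcj
  rw [hh]
  linarith

theorem inner_direction_bnode_lt (hT : T.IsAdmissible Ω) (h : y ∈ T.bnode i) (hx : x ∈ T.cell i) :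
    inner ℝ (direction (T.node i) y) x <
      inner ℝ (direction (T.node i) y) (T.node i) + T.bh i y := by
  set ν := direction (T.node i) y
  set c := inner ℝ ν (T.node i) + T.bh i y
  have hdisj : Disjoint (T.cell i) (hyperplane ν c) := by
    by_contra hmeet
    have hne := not_disjoint_iff_nonempty_inter.1 hmeet
    have hnull := surfaceMeasure_frontier_inter_hyperplane (hT.isOpen_cell i) (hT.convex_cell i)
      (direction_ne_zero (hT.node_ne_of_mem_bnode h)) hne
    rw [surfaceMeasure_euclideanSpace] at hnull
    exact (hT.bnode_pos i y h).ne' (measure_mono_null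
      (subset_inter (fun q hq => hq.1.1) (T.bface_subset_hyperplane Ω i y)) hnull)
  refine (lt_or_gt_of_disjoint_hyperplane (hT.convex_cell i) hdisj).resolve_right (fun hgt => ?_) x
    hx
  linarith [le_inner_of_mem_closure hgt (hT.node_mem i), hT.bh_pos h]

theorem surf_face_inter_face (hT : T.IsAdmissible Ω) (hj : T.Adj i j) (hk : T.Adj i k)
    (hjk : j ≠ k) : surf d (T.face i j ∩ T.face i k) = 0 := by
  by_contra hne
  set ν := direction (T.node i) (T.node j)
  set c := inner ℝ ν (T.node i) + T.dist1 i j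
  obtain ⟨a, ha⟩ := hT.nonempty i
  obtain ⟨b, hb⟩ := hT.nonempty j
  obtain ⟨e, he⟩ := hT.nonempty k
  have hopp : ∀ l, l ≠ k → T.face i j ⊆ closure (T.cell l) →
      ((∀ x ∈ T.cell l, inner ℝ ν x < c) ∧ ∀ x ∈ T.cell k, c < inner ℝ ν x) ∨
        ((∀ x ∈ T.cell l, c < inner ℝ ν x) ∧ ∀ x ∈ T.cell k, inner ℝ ν x < c) := by
    intro l hlk hl
    refine opposite_sides (hT.isOpen_cell l) (hT.isOpen_cell k) (hT.convex_cell l)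
      (hT.convex_cell k) (hT.disjoint l k hlk) (direction_ne_zero (hT.node_ne hj)) ?_
    rw [surfaceMeasure_euclideanSpace]
    exact (pos_iff_ne_zero.2 hne).trans_le (measure_mono fun x hx =>
      ⟨⟨hl hx.1, (T.face_subset_closure_inter i k hx.2).2⟩, hT.face_subset_hyperplane hj hx.1⟩)
  have hia := hT.inner_direction_lt hj ha
  have hjb := hT.lt_inner_direction hj hb
  rcases hopp i hk.1 (T.face_subset_closure i j) with ⟨-, hgt⟩ | ⟨hgt, -⟩
  · rcases hopp j hjk fun x hx => (T.face_subset_closure_inter i j hx).2 with ⟨hlt, -⟩ | ⟨-, hlt⟩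
    · exact (hlt b hb).not_gt hjb
    · exact (hlt e he).not_gt (hgt e he)
  · exact (hgt a ha).not_gt hia

theorem surf_face_inter_bface (hΩ : IsPolygonalDomain Ω) (hT : T.IsAdmissible Ω) (hj : T.Adj i j)
    (y : Sp d) : surf d (T.face i j ∩ T.bface Ω i y) = 0 := by
  obtain ⟨a, ha⟩ := hT.nonempty i
  obtain ⟨b, hb⟩ := hT.nonempty j
  rw [← surfaceMeasure_euclideanSpace]
  refine measure_mono_null ?_ (surfaceMeasure_inter_diff_interior_union (hT.convex_cell i).closure
    (hT.convex_cell j).closure (direction_ne_zero (hT.node_ne hj)) (subset_closure ha)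
    (hT.inner_direction_lt hj ha) (subset_closure hb) (hT.lt_inner_direction hj hb))
  rintro x ⟨hx, hxb⟩
  refine ⟨⟨T.face_subset_closure_inter i j hx, fun hint => ?_⟩, hT.face_subset_hyperplane hj hx⟩
  have hxΩ : x ∈ Ω := hΩ.interior_closure ▸
    interior_mono (union_subset (hT.closure_cell_subset i) (hT.closure_cell_subset j)) hint
  exact (hΩ.isOpen.frontier_eq ▸ hxb.1.2 : x ∈ closure Ω \ Ω).2 hxΩ

theorem surf_bface_inter_bface (hT : T.IsAdmissible Ω) (hy : y ∈ T.bnode i) (hz : z ∈ T.bnode i)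
    (hyz : y ≠ z) : surf d (T.bface Ω i y ∩ T.bface Ω i z) = 0 := by
  by_contra hne
  have hyi := hT.node_ne_of_mem_bnode hy
  have hzi := hT.node_ne_of_mem_bnode hz
  obtain ⟨t, hdir, hoff⟩ := exists_smul_of_surfaceMeasure_pos
    (c := inner ℝ (direction (T.node i) y) (T.node i) + T.bh i y)
    (s := inner ℝ (direction (T.node i) z) (T.node i) + T.bh i z) (direction_ne_zero hyi) <| by
    rw [surfaceMeasure_euclideanSpace]
    exact (pos_iff_ne_zero.2 hne).trans_le (measure_mono fun x hx =>
      ⟨T.bface_subset_hyperplane Ω i z hx.2, T.bface_subset_hyperplane Ω i y hx.1⟩)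
  have hbh : T.bh i z = t * T.bh i y := by
    rw [hdir, real_inner_smul_left] at hoff
    linarith
  have ht : 0 < t := pos_of_mul_pos_left (hbh ▸ hT.bh_pos hz) (hT.bh_pos hy).le
  have ht1 : t = 1 := by
    have hnorm := congrArg norm hdir
    rwa [norm_smul, norm_direction hzi, norm_direction hyi, mul_one, Real.norm_of_nonneg ht.le,
      eq_comm] at hnorm
  rw [ht1, one_smul, direction, direction] at hdir
  rw [ht1, one_mul, bh, bh] at hbh
  rw [hbh] at hdir
  exact hyz (sub_left_injective
    (smul_right_injective (Sp d) (inv_ne_zero (dist_pos.2 hyi).ne') hdir)).symm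

theorem hasFaces_cell (hΩ : IsPolygonalDomain Ω) (hT : T.IsAdmissible Ω) (i : Fin T.N) :
    HasFaces (ι := T.nbrs i ⊕ T.bnode i) (T.cell i)
      (Sum.elim (fun j => direction (T.node i) (T.node j)) fun y => direction (T.node i) y)
      (Sum.elim
        (fun j => inner ℝ (direction (T.node i) (T.node j)) (T.node i) + T.dist1 i j)
        fun y => inner ℝ (direction (T.node i) y) (T.node i) + T.bh i y)
      (Sum.elim (fun j => T.face i j) fun y => T.bface Ω i y) where
  isOpen := hT.isOpen_cell i
  convex := hT.convex_cell i
  nonempty := hT.nonempty i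
  isBounded := hT.isBounded_cell i
  norm_normal := by
    rintro (j | y)
    · exact norm_direction (hT.node_ne (mem_nbrs.1 j.2))
    · exact norm_direction (hT.node_ne_of_mem_bnode y.2)
  inner_lt := by
    rintro (j | y) x hx
    · exact hT.inner_direction_lt (mem_nbrs.1 j.2) hx
    · exact hT.inner_direction_bnode_lt y.2 hx
  isClosed := by
    rintro (j | y)
    · exact T.isClosed_face i j
    · exact T.isClosed_bface Ω i y
  subset := by
    rintro (j | y)
    · exact hT.face_subset_hyperplane (mem_nbrs.1 j.2)
    · exact T.bface_subset_hyperplane Ω i y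
  frontier_eq := by
    rw [hT.boundary i, iUnion_sum]
    congr 1
    · simp only [Sum.elim_inl, iUnion_subtype, mem_nbrs, mem_ofPred_eq]
    · simp only [Sum.elim_inr, iUnion_subtype]
  null := by
    rw [surfaceMeasure_euclideanSpace]
    rintro (j | y) (k | z) hne
    · exact hT.surf_face_inter_face (mem_nbrs.1 j.2) (mem_nbrs.1 k.2)
        fun h => hne (by rw [Subtype.ext h])
    · exact hT.surf_face_inter_bface hΩ (mem_nbrs.1 j.2) z
    · rw [inter_comm]
      exact hT.surf_face_inter_bface hΩ (mem_nbrs.1 k.2) y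
    · exact hT.surf_bface_inter_bface y.2 z.2 fun h => hne (by rw [Subtype.ext h])

theorem integral_divergence_cell (hΩ : IsPolygonalDomain Ω) (hT : T.IsAdmissible Ω) (i : Fin T.N)
    {F : Sp d → Sp d} {L : NNReal} (hF : LipschitzOnWith L F (closure (T.cell i)))
    (hdiff : DifferentiableOn ℝ F (T.cell i)) :
    ∫ x in T.cell i, divergence F x =
      ∑ j ∈ T.nbrs i,
        ∫ x in T.face i j, inner ℝ (F x) (direction (T.node i) (T.node j)) ∂surf d +
      ∑ y ∈ T.bnode i, ∫ x in T.bface Ω i y, inner ℝ (F x) (direction (T.node i) y) ∂surf d := by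
  rw [(hT.hasFaces_cell hΩ i).integral_divergence hF hdiff, Fintype.sum_sum_type]
  simp only [Sum.elim_inl, Sum.elim_inr]
  rw [← Finset.sum_coe_sort (T.nbrs i), ← Finset.sum_coe_sort (T.bnode i)]

theorem surf_face_lt_top (hT : T.IsAdmissible Ω) (h : T.Adj i j) : surf d (T.face i j) < ⊤ := by
  rw [← surfaceMeasure_euclideanSpace]
  exact surfaceMeasure_lt_top (direction_ne_zero (hT.node_ne h)) (hT.isCompact_face i j).isBounded
    (hT.face_subset_hyperplane h)

theorem surf_bface_lt_top (hT : T.IsAdmissible Ω) (h : y ∈ T.bnode i) :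
    surf d (T.bface Ω i y) < ⊤ := by
  rw [← surfaceMeasure_euclideanSpace]
  exact surfaceMeasure_lt_top (direction_ne_zero (hT.node_ne_of_mem_bnode h))
    (hT.isCompact_bface i y).isBounded (T.bface_subset_hyperplane Ω i y)

theorem m_pos (hT : T.IsAdmissible Ω) (h : T.Adj i j) : 0 < T.m i j :=
  ENNReal.toReal_pos h.2.ne' (hT.surf_face_lt_top h).ne

theorem bm_pos (hT : T.IsAdmissible Ω) (h : y ∈ T.bnode i) : 0 < T.bm Ω i y :=
  ENNReal.toReal_pos (hT.bnode_pos i y h).ne' (hT.surf_bface_lt_top h).ne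

theorem divergence_sub_const (x₀ x : Sp d) : divergence (fun z => z - x₀) x = d := by
  have h : fderiv ℝ (fun z : Sp d => z - x₀) x = ContinuousLinearMap.id ℝ (Sp d) :=
    ((hasFDerivAt_id x).sub_const x₀).fderiv
  simp [divergence, h]

theorem sum_integral_sub_const (hΩ : IsPolygonalDomain Ω) (hT : T.IsAdmissible Ω) (i : Fin T.N)
    (x₀ : Sp d) :
    ∑ j ∈ T.nbrs i,
        ∫ x in T.face i j, inner ℝ (x - x₀) (direction (T.node i) (T.node j)) ∂surf d +
      ∑ y ∈ T.bnode i, ∫ x in T.bface Ω i y, inner ℝ (x - x₀) (direction (T.node i) y) ∂surf d =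
    d * volume.real (T.cell i) := by
  rw [← hT.integral_divergence_cell hΩ i (F := fun x => x - x₀) (L := 1)
    (LipschitzWith.of_dist_le_mul fun x y => by simp).lipschitzOnWith (by fun_prop)]
  simp only [divergence_sub_const, setIntegral_const, smul_eq_mul, mul_comm]

/- The divergence of the position vector: the pyramids over the interfaces fill the cell. -/
theorem sum_m_mul_dist1_add (hΩ : IsPolygonalDomain Ω) (hT : T.IsAdmissible Ω) (i : Fin T.N) :
    ∑ j ∈ T.nbrs i, T.m i j * T.dist1 i j + ∑ y ∈ T.bnode i, T.bm Ω i y * T.bh i y =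
      d * volume.real (T.cell i) := by
  have hconst : ∀ {A : Set (Sp d)} {ν : Sp d} {r : ℝ}, IsClosed A →
      A ⊆ hyperplane ν (inner ℝ ν (T.node i) + r) →
      ∫ x in A, inner ℝ (x - T.node i) ν ∂surf d = (surf d).real A * r := by
    intro A ν r hA hsub
    rw [setIntegral_congr_fun (g := fun _ => r) hA.measurableSet, setIntegral_const, smul_eq_mul]
    intro x hx
    change inner ℝ (x - T.node i) ν = r
    rw [real_inner_comm, inner_sub_right, mem_hyperplane.1 (hsub hx), add_sub_cancel_left]
  rw [← hT.sum_integral_sub_const hΩ i (T.node i)]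
  congr 1
  · exact Finset.sum_congr rfl fun j hj =>
      (hconst (T.isClosed_face i j) (hT.face_subset_hyperplane (mem_nbrs.1 hj))).symm
  · exact Finset.sum_congr rfl fun y _ =>
      (hconst (T.isClosed_bface Ω i y) (T.bface_subset_hyperplane Ω i y)).symm

end IsAdmissible

end Mesh

namespace Mesh

variable {T : Mesh d} {Ω : Set (Sp d)}

theorem edgeSum_mono {w w' : Fin T.N → Fin T.N → ℝ} {b b' : Fin T.N → Sp d → ℝ}
    (hw : ∀ i j, T.Adj i j → w i j ≤ w' i j) (hb : ∀ i, ∀ y ∈ T.bnode i, b i y ≤ b' i y) :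
    T.edgeSum w b ≤ T.edgeSum w' b' :=
  add_le_add
    (Finset.sum_le_sum fun i _ => Finset.sum_le_sum fun j hj =>
      hw i j (mem_nbrs.1 (Finset.mem_of_mem_filter j hj)))
    (Finset.sum_le_sum fun i _ => Finset.sum_le_sum fun y hy => hb i y hy)

theorem edgeSum_congr {w w' : Fin T.N → Fin T.N → ℝ} {b b' : Fin T.N → Sp d → ℝ}
    (hw : ∀ i j, T.Adj i j → w i j = w' i j) (hb : ∀ i, ∀ y ∈ T.bnode i, b i y = b' i y) :
    T.edgeSum w b = T.edgeSum w' b' :=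
  le_antisymm (edgeSum_mono (fun i j h => (hw i j h).le) fun i y h => (hb i y h).le)
    (edgeSum_mono (fun i j h => (hw i j h).ge) fun i y h => (hb i y h).ge)

theorem edgeSum_add (w w' : Fin T.N → Fin T.N → ℝ) (b b' : Fin T.N → Sp d → ℝ) :
    T.edgeSum (fun i j => w i j + w' i j) (fun i y => b i y + b' i y) =
      T.edgeSum w b + T.edgeSum w' b' := by
  simp only [edgeSum, Finset.sum_add_distrib]
  ring

theorem edgeSum_const_mul (c : ℝ) (w : Fin T.N → Fin T.N → ℝ) (b : Fin T.N → Sp d → ℝ) :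
    T.edgeSum (fun i j => c * w i j) (fun i y => c * b i y) = c * T.edgeSum w b := by
  simp only [edgeSum, ← Finset.mul_sum, mul_add]

theorem edgeSum_neg (w : Fin T.N → Fin T.N → ℝ) (b : Fin T.N → Sp d → ℝ) :
    T.edgeSum (fun i j => -w i j) (fun i y => -b i y) = -T.edgeSum w b := by
  simp only [edgeSum, Finset.sum_neg_distrib, neg_add]

theorem sum_nbrs (T : Mesh d) (g : Fin T.N → Fin T.N → ℝ) :
    ∑ i, ∑ j ∈ T.nbrs i, g i j =
      ∑ i, ∑ j ∈ (T.nbrs i).filter (fun j => i < j), (g i j + g j i) := by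
  have hswap : ∑ i, ∑ j ∈ (T.nbrs i).filter (fun j => ¬i < j), g i j =
      ∑ i, ∑ j ∈ (T.nbrs i).filter (fun j => i < j), g j i := by
    refine Finset.sum_comm' fun i j => ?_
    simp only [Finset.mem_univ, true_and, and_true, Finset.mem_filter, mem_nbrs, not_lt]
    exact ⟨fun h => ⟨h.1.symm, h.2.lt_of_ne h.1.1.symm⟩, fun h => ⟨h.1.symm, h.2.le⟩⟩
  simp_rw [Finset.sum_add_distrib]
  rw [← hswap, ← Finset.sum_add_distrib]
  exact Finset.sum_congr rfl fun i _ => (Finset.sum_filter_add_sum_filter_not _ _ _).symm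

theorem sum_mul_nbrs (T : Mesh d) (e : Fin T.N → ℝ) (q : Fin T.N → Fin T.N → ℝ)
    (b : Fin T.N → Sp d → ℝ) :
    ∑ i, e i * (∑ j ∈ T.nbrs i, q i j + ∑ y ∈ T.bnode i, b i y) =
      T.edgeSum (fun i j => e i * q i j + e j * q j i) (fun i y => e i * b i y) := by
  simp only [mul_add, Finset.sum_add_distrib, Finset.mul_sum, edgeSum]
  rw [sum_nbrs]
  simp only [Finset.sum_add_distrib]

theorem sum_mul_flux (T : Mesh d) (e : Fin T.N → ℝ) {q : Fin T.N → Fin T.N → ℝ}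
    {b : Fin T.N → Sp d → ℝ} (hq : ∀ i j, T.Adj i j → q j i = -q i j) :
    ∑ i, e i * (∑ j ∈ T.nbrs i, q i j + ∑ y ∈ T.bnode i, b i y) =
      -T.edgeSum (fun i j => q i j * (e j - e i)) (fun i y => b i y * (0 - e i)) := by
  rw [sum_mul_nbrs, ← edgeSum_neg]
  refine edgeSum_congr (fun i j h => ?_) fun i y _ => by ring
  rw [hq i j h]
  ring

theorem edgeSum_mul_sq_eq {a r : Fin T.N → Fin T.N → ℝ} {b s : Fin T.N → Sp d → ℝ}
    {e : Fin T.N → ℝ} (ha : ∀ i j, T.Adj i j → a j i = a i j)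
    (hr : ∀ i j, T.Adj i j → r j i = -r i j)
    (he : ∀ i, ∑ j ∈ T.nbrs i, a i j * (e j - e i) + ∑ y ∈ T.bnode i, b i y * (0 - e i) =
      ∑ j ∈ T.nbrs i, r i j + ∑ y ∈ T.bnode i, s i y) :
    T.edgeSum (fun i j => a i j * (e j - e i) ^ 2) (fun i y => b i y * (0 - e i) ^ 2) =
      T.edgeSum (fun i j => r i j * (e j - e i)) (fun i y => s i y * (0 - e i)) := by
  rw [← neg_inj, ← T.sum_mul_flux e hr]
  simp_rw [← he, sq, ← mul_assoc]
  exact (T.sum_mul_flux e fun i j h => by rw [ha i j h]; ring).symm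

theorem edgeSum_mul_sq_le {a r : Fin T.N → Fin T.N → ℝ} {b s : Fin T.N → Sp d → ℝ}
    {e : Fin T.N → ℝ} (ha : ∀ i j, T.Adj i j → a j i = a i j)
    (hr : ∀ i j, T.Adj i j → r j i = -r i j)
    (he : ∀ i, ∑ j ∈ T.nbrs i, a i j * (e j - e i) + ∑ y ∈ T.bnode i, b i y * (0 - e i) =
      ∑ j ∈ T.nbrs i, r i j + ∑ y ∈ T.bnode i, s i y)
    (ha_pos : ∀ i j, T.Adj i j → 0 < a i j) (hb_pos : ∀ i, ∀ y ∈ T.bnode i, 0 < b i y) :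
    T.edgeSum (fun i j => a i j * (e j - e i) ^ 2) (fun i y => b i y * (0 - e i) ^ 2) ≤
      T.edgeSum (fun i j => r i j ^ 2 / a i j) (fun i y => s i y ^ 2 / b i y) := by
  have young : ∀ {α ρ δ : ℝ}, 0 < α → 2 * (ρ * δ) ≤ α * δ ^ 2 + ρ ^ 2 / α := by
    intro α ρ δ hα
    have hsq : α * δ ^ 2 + ρ ^ 2 / α - 2 * (ρ * δ) = (α * δ - ρ) ^ 2 / α := by
      field_simp
      ring
    linarith [show 0 ≤ (α * δ - ρ) ^ 2 / α by positivity]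
  have hle := edgeSum_mono (T := T)
    (fun i j h => young (ρ := r i j) (δ := e j - e i) (ha_pos i j h))
    fun i y h => young (ρ := s i y) (δ := 0 - e i) (hb_pos i y h)
  rw [edgeSum_const_mul, edgeSum_add, ← edgeSum_mul_sq_eq ha hr he] at hle
  linarith

/-- The squared discrete `H¹` seminorm, with unit coefficient, of a function on the cells that is
extended by zero to the boundary nodes. -/
def seminormSq (T : Mesh d) (Ω : Set (Sp d)) (e : Fin T.N → ℝ) : ℝ :=
  T.edgeSum (fun i j => T.m i j / T.hh i j * (e j - e i) ^ 2)
    (fun i y => T.bm Ω i y / T.bh i y * (0 - e i) ^ 2)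

/-- A squared discrete `L²` norm of a function on the cells that is extended by zero to the boundary
nodes. The weight `m_ij h_ij` is `d` times the volume of the two pyramids with base `σ_ij` and
apices `x_i`, `x_j`. -/
def edgeMassSq (T : Mesh d) (Ω : Set (Sp d)) (e : Fin T.N → ℝ) : ℝ :=
  T.edgeSum (fun i j => T.m i j * T.hh i j * (e i ^ 2 + e j ^ 2))
    (fun i y => T.bm Ω i y * T.bh i y * e i ^ 2)

theorem neg_mul_sq_sub_sq_le {D m h a b Φ : ℝ} (hm : 0 < m) (hh : 0 < h) (hΦ : |Φ| ≤ D * m) :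
    -(Φ * (b ^ 2 - a ^ 2)) ≤
      3 * D ^ 2 * (m / h * (b - a) ^ 2) + 1 / 6 * (m * h * (a ^ 2 + b ^ 2)) := by
  have habs : -(Φ * (b ^ 2 - a ^ 2)) ≤ D * m * (|b - a| * |b + a|) := by
    calc -(Φ * (b ^ 2 - a ^ 2)) ≤ |Φ * (b ^ 2 - a ^ 2)| := neg_le_abs _
      _ = |Φ| * (|b - a| * |b + a|) := by rw [abs_mul, ← abs_mul (b - a)]; ring_nf
      _ ≤ D * m * (|b - a| * |b + a|) := by gcongr
  have hyoung : 12 * (D * m * (|b - a| * |b + a|)) ≤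
      36 * D ^ 2 * (m / h * (b - a) ^ 2) + m * h * (b + a) ^ 2 := by
    have hsq : m / h * (6 * D * |b - a| - h * |b + a|) ^ 2 =
        36 * D ^ 2 * (m / h * |b - a| ^ 2) - 12 * (D * m * (|b - a| * |b + a|)) +
          m * h * |b + a| ^ 2 := by
      field_simp
      ring
    rw [sq_abs, sq_abs] at hsq
    linarith [show 0 ≤ m / h * (6 * D * |b - a| - h * |b + a|) ^ 2 by positivity]
  have hadd : m * h * (b + a) ^ 2 ≤ m * h * (2 * (b ^ 2 + a ^ 2)) := by
    gcongr
    exact add_sq_le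
  linarith

theorem mul_sq_add_sq_le {α β m h D a b : ℝ} (hα : 0 ≤ α) (hβ : 0 ≤ β) (hαβ : α + β = h)
    (hm : 0 ≤ m) (hh : 0 < h) (hD : h ≤ D) :
    m * h * (a ^ 2 + b ^ 2) ≤
      3 * (m * (α * a ^ 2 + β * b ^ 2)) + 2 * D ^ 2 * (m / h * (b - a) ^ 2) := by
  have hβa : β * a ^ 2 ≤ β * (2 * b ^ 2 + 2 * (b - a) ^ 2) := by
    gcongr
    nlinarith [sq_nonneg (2 * b - a)]
  have hαb : α * b ^ 2 ≤ α * (2 * a ^ 2 + 2 * (b - a) ^ 2) := by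
    gcongr
    nlinarith [sq_nonneg (2 * a - b)]
  calc m * h * (a ^ 2 + b ^ 2)
      ≤ 3 * (m * (α * a ^ 2 + β * b ^ 2)) + 2 * h ^ 2 * (m / h * (b - a) ^ 2) := by
        have hcancel : h ^ 2 * (m / h * (b - a) ^ 2) = m * (h * (b - a) ^ 2) := by field_simp
        have hkey : h * (a ^ 2 + b ^ 2) ≤ 3 * (α * a ^ 2 + β * b ^ 2) + 2 * (h * (b - a) ^ 2) := by
          rw [← hαβ]
          linarith
        linarith [mul_le_mul_of_nonneg_left hkey hm]
    _ ≤ 3 * (m * (α * a ^ 2 + β * b ^ 2)) + 2 * D ^ 2 * (m / h * (b - a) ^ 2) := by gcongr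

namespace IsAdmissible

theorem hh_le_diam (hΩ : IsPolygonalDomain Ω) (hT : T.IsAdmissible Ω) (i j : Fin T.N) :
    T.hh i j ≤ Metric.diam Ω :=
  hΩ.dist_le_diam (hT.node_mem_closure i) (hT.node_mem_closure j)

theorem edgeMassSq_le_sum (hΩ : IsPolygonalDomain Ω) (hT : T.IsAdmissible Ω) (e : Fin T.N → ℝ) :
    T.edgeMassSq Ω e ≤ 3 * ∑ i, e i ^ 2 * (d * volume.real (T.cell i)) +
      2 * Metric.diam Ω ^ 2 * T.seminormSq Ω e := by
  simp_rw [← hT.sum_m_mul_dist1_add hΩ, sum_mul_nbrs]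
  rw [edgeMassSq, seminormSq, ← edgeSum_const_mul, ← edgeSum_const_mul, ← edgeSum_add]
  refine edgeSum_mono (fun i j h => ?_) fun i y h => ?_
  · refine (mul_sq_add_sq_le Metric.infDist_nonneg Metric.infDist_nonneg (hT.dist1_add h)
      (hT.m_pos h).le (hT.hh_pos h) (hT.hh_le_diam hΩ i j)).trans_eq ?_
    rw [T.m_comm j i, dist1, dist1]
    ring
  · have hm := hT.bm_pos h
    have hh := hT.bh_pos h
    have hmass : 0 ≤ T.bm Ω i y * T.bh i y * e i ^ 2 := by positivity
    have hsemi : 0 ≤ 2 * Metric.diam Ω ^ 2 * (T.bm Ω i y / T.bh i y * (0 - e i) ^ 2) := by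
      positivity
    linarith

theorem abs_integral_face_le (hT : T.IsAdmissible Ω) {i j : Fin T.N} (h : T.Adj i j)
    {g : Sp d → ℝ} {B : ℝ} (hg : ∀ x ∈ T.face i j, |g x| ≤ B) :
    |∫ x in T.face i j, g x ∂surf d| ≤ B * T.m i j := by
  rw [← Real.norm_eq_abs]
  exact norm_setIntegral_le_of_norm_le_const (hT.surf_face_lt_top h) hg

theorem abs_integral_bface_le (hT : T.IsAdmissible Ω) {i : Fin T.N} {y : Sp d} (h : y ∈ T.bnode i)
    {g : Sp d → ℝ} {B : ℝ} (hg : ∀ x ∈ T.bface Ω i y, |g x| ≤ B) :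
    |∫ x in T.bface Ω i y, g x ∂surf d| ≤ B * T.bm Ω i y := by
  rw [← Real.norm_eq_abs]
  exact norm_setIntegral_le_of_norm_le_const (hT.surf_bface_lt_top h) hg

/- Summation by parts against the fluxes of the position vector, whose divergence is `d`. -/
theorem sum_sq_mul_volume_le (hΩ : IsPolygonalDomain Ω) (hT : T.IsAdmissible Ω)
    (e : Fin T.N → ℝ) :
    ∑ i, e i ^ 2 * (d * volume.real (T.cell i)) ≤
      3 * Metric.diam Ω ^ 2 * T.seminormSq Ω e + 1 / 6 * T.edgeMassSq Ω e := by
  obtain ⟨x₀, hx₀⟩ := hΩ.isConnected.nonempty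
  have hbound : ∀ x ∈ closure Ω, ∀ ν : Sp d, ‖ν‖ = 1 → |inner ℝ (x - x₀) ν| ≤ Metric.diam Ω :=
    fun x hx ν hν => by
      calc |inner ℝ (x - x₀) ν| ≤ ‖x - x₀‖ * ‖ν‖ := abs_real_inner_le_norm _ _
        _ = dist x x₀ := by rw [hν, mul_one, dist_eq_norm]
        _ ≤ Metric.diam Ω := hΩ.dist_le_diam hx (subset_closure hx₀)
  simp_rw [← hT.sum_integral_sub_const hΩ _ x₀]
  rw [sum_mul_flux, seminormSq, edgeMassSq, ← edgeSum_const_mul, ← edgeSum_const_mul,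
    ← edgeSum_add, ← edgeSum_neg]
  · refine edgeSum_mono (fun i j h => ?_) fun i y h => ?_
    · exact neg_mul_sq_sub_sq_le (hT.m_pos h) (hT.hh_pos h) <| hT.abs_integral_face_le h fun x hx =>
        hbound x (hT.closure_cell_subset i (T.face_subset_closure i j hx)) _
          (norm_direction (hT.node_ne h))
    · simpa using neg_mul_sq_sub_sq_le (a := e i) (b := 0) (hT.bm_pos h) (hT.bh_pos h) <|
        hT.abs_integral_bface_le h fun x hx =>
          hbound x (hT.closure_cell_subset i (T.bface_subset_closure Ω i y hx)) _
            (norm_direction (hT.node_ne_of_mem_bnode h))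
  · intro i j _
    simp only [T.face_comm j i, direction_comm (T.node i), inner_neg_right, integral_neg]

theorem edgeMassSq_le_seminormSq (hΩ : IsPolygonalDomain Ω) (hT : T.IsAdmissible Ω)
    (e : Fin T.N → ℝ) :
    T.edgeMassSq Ω e ≤ 22 * Metric.diam Ω ^ 2 * T.seminormSq Ω e := by
  linarith [hT.edgeMassSq_le_sum hΩ e, hT.sum_sq_mul_volume_le hΩ e]

theorem edgeSum_m_mul_hh_le (hΩ : IsPolygonalDomain Ω) (hT : T.IsAdmissible Ω) :
    T.edgeSum (fun i j => T.m i j * T.hh i j) (fun i y => T.bm Ω i y * T.bh i y) ≤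
      d * volume.real Ω := by
  have hpyramids : T.edgeSum (fun i j => T.m i j * T.hh i j) (fun i y => T.bm Ω i y * T.bh i y) =
      d * ∑ i, volume.real (T.cell i) := by
    have hsum := T.sum_mul_nbrs 1 (fun i j => T.m i j * T.dist1 i j)
      fun i y => T.bm Ω i y * T.bh i y
    simp only [hT.sum_m_mul_dist1_add hΩ, Pi.one_apply, one_mul, ← Finset.mul_sum] at hsum
    rw [hsum]
    refine edgeSum_congr (fun i j h => ?_) fun i y _ => rfl
    rw [T.m_comm j i, ← hT.dist1_add h, mul_add]
  rw [hpyramids, ← measureReal_iUnion_fintype (fun i j hij => hT.disjoint i j hij)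
    (fun i => (hT.isOpen_cell i).measurableSet) fun i => (hT.isBounded_cell i).measure_lt_top.ne]
  gcongr
  · exact hΩ.isBounded.measure_lt_top.ne
  · exact iUnion_subset (hT.cell_subset hΩ)

end IsAdmissible

end Mesh

/-- A symmetric mean on the positive reals, without any regularity. -/
structure IsSymmetricMean (S : ℝ → ℝ → ℝ) : Prop where
  symm : ∀ {x y}, 0 < x → 0 < y → S x y = S y x
  mem_uIcc : ∀ {x y}, 0 < x → 0 < y → S x y ∈ uIcc x y

theorem IsSmoothMean.isSymmetricMean {S : ℝ → ℝ → ℝ} (hS : IsSmoothMean S) :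
    IsSymmetricMean S where
  symm hx hy := hS.symm _ _ hx hy
  mem_uIcc hx hy := ⟨hS.min_le _ _ hx hy, hS.le_max _ _ hx hy⟩

theorem IsSymmetricMean.mem_Icc {S : ℝ → ℝ → ℝ} (hS : IsSymmetricMean S) {x y p₁ p₂ : ℝ}
    (hp₁ : 0 < p₁) (hx : x ∈ Icc p₁ p₂) (hy : y ∈ Icc p₁ p₂) : S x y ∈ Icc p₁ p₂ :=
  uIcc_subset_Icc hx hy (hS.mem_uIcc (hp₁.trans_le hx.1) (hp₁.trans_le hy.1))

theorem IsSymmetricMean.abs_sub_le {S : ℝ → ℝ → ℝ} (hS : IsSymmetricMean S) {x y q B : ℝ}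
    (hx : 0 < x) (hy : 0 < y) (hqx : |q - x| ≤ B) (hqy : |q - y| ≤ B) : |q - S x y| ≤ B := by
  rw [mem_Icc_iff_abs_le] at *
  exact uIcc_subset_Icc hqx hqy (hS.mem_uIcc hx hy)

section Divergence

variable {Ω : Set (Sp d)}

theorem divergence_add {F G : Sp d → Sp d} {x : Sp d} (hF : DifferentiableAt ℝ F x)
    (hG : DifferentiableAt ℝ G x) :
    divergence (fun z => F z + G z) x = divergence F x + divergence G x := by
  simp only [divergence, fderiv_fun_add hF hG, add_apply, PiLp.add_apply, Finset.sum_add_distrib]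

theorem gradientWithin_apply (w : Sp d → ℝ) (s : Set (Sp d)) (x : Sp d) (k : Fin d) :
    gradientWithin w s x k = fderivWithin ℝ w s x (EuclideanSpace.single k 1) := by
  rw [← inner_gradientWithin_left, EuclideanSpace.inner_single_right, one_mul, RCLike.conj_to_real]

theorem contDiffOn_gradientWithin {s : Set (Sp d)} {w : Sp d → ℝ} (hw : ContDiffOn ℝ 2 w s)
    (hs : UniqueDiffOn ℝ s) : ContDiffOn ℝ 1 (gradientWithin w s) s := by
  simp only [contDiffOn_euclidean, gradientWithin_apply]
  exact fun k => (hw.fderivWithin hs (by norm_num)).clm_apply contDiffOn_const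

theorem gradientWithin_of_mem_nhds {s : Set (Sp d)} {w : Sp d → ℝ} {x : Sp d} (h : s ∈ 𝓝 x) :
    gradientWithin w s x = gradient w x := by
  rw [gradientWithin, gradient, fderivWithin_of_mem_nhds h]

theorem differentiableAt_gradient {w : Sp d → ℝ} {x : Sp d} (hw : ContDiffAt ℝ 2 w x) :
    DifferentiableAt ℝ (gradient w) x := by
  simp only [differentiableAt_euclidean, ← gradientWithin_univ, gradientWithin_apply,
    fderivWithin_univ]
  exact fun k => ((hw.fderiv_right (m := 1) (by norm_num)).clm_apply
    contDiffAt_const).differentiableAt one_ne_zero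

theorem exp_neg_smul_gradient_div {u V : Sp d → ℝ} {x : Sp d} (hu : DifferentiableAt ℝ u x)
    (hV : DifferentiableAt ℝ V x) :
    Real.exp (-V x) • gradient (fun z => u z / Real.exp (-V z)) x =
      gradient u x + u x • gradient V x := by
  refine ext_inner_right ℝ fun v => ?_
  have hquot : (fun z => u z / Real.exp (-V z)) = fun z => u z * Real.exp (V z) := by
    simp only [Real.exp_neg, div_inv_eq_mul]
  rw [hquot, real_inner_smul_left, inner_gradient_left,
    (hu.hasFDerivAt.fun_mul hV.hasFDerivAt.exp).fderiv]
  simp only [inner_add_left, real_inner_smul_left, inner_gradient_left, add_apply, smul_apply,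
    smul_eq_mul, Real.exp_neg]
  field_simp
  ring

theorem divergence_flux (hΩ : IsOpen Ω) {κ V u : Sp d → ℝ} (hκ : ContDiffOn ℝ 1 κ (closure Ω))
    (hV : ContDiffOn ℝ 2 V (closure Ω)) (hu : ContDiffOn ℝ 2 u (closure Ω)) {x : Sp d}
    (hx : x ∈ Ω) :
    divergence (fun z => (Real.exp (-V z) * κ z) •
        gradientWithin (fun y => u y / Real.exp (-V y)) (closure Ω) z) x =
      divergence (fun z => κ z • gradient u z) x +
        divergence (fun z => (κ z * u z) • gradient V z) x := by
  have hnhds : ∀ z ∈ Ω, closure Ω ∈ 𝓝 z := fun z hz =>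
    mem_of_superset (hΩ.mem_nhds hz) subset_closure
  have hVx := fun z hz => hV.contDiffAt (hnhds z hz)
  have hux := fun z hz => hu.contDiffAt (hnhds z hz)
  have hκx : DifferentiableAt ℝ κ x := (hκ.contDiffAt (hnhds x hx)).differentiableAt one_ne_zero
  have hflux : (fun z => (Real.exp (-V z) * κ z) •
        gradientWithin (fun y => u y / Real.exp (-V y)) (closure Ω) z) =ᶠ[𝓝 x]
      fun z => κ z • gradient u z + (κ z * u z) • gradient V z := by
    filter_upwards [hΩ.mem_nhds hx] with z hz
    rw [gradientWithin_of_mem_nhds (hnhds z hz), mul_comm, mul_smul, exp_neg_smul_gradient_div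
      ((hux z hz).differentiableAt two_ne_zero) ((hVx z hz).differentiableAt two_ne_zero),
      smul_add, smul_smul]
  rw [divergence, hflux.fderiv_eq]
  exact divergence_add (hκx.smul (differentiableAt_gradient (hux x hx)))
    ((hκx.mul ((hux x hx).differentiableAt two_ne_zero)).smul
      (differentiableAt_gradient (hVx x hx)))

end Divergence

theorem mul_div_add_mem_Icc {a b α β lo hi : ℝ} (hlo : 0 < lo) (ha : a ∈ Icc lo hi)
    (hb : b ∈ Icc lo hi) (hα : 0 ≤ α) (hβ : 0 ≤ β) (hαβ : α + β = 1) :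
    a * b / (a * α + b * β) ∈ Icc lo hi := by
  have ha0 : 0 < a := hlo.trans_le ha.1
  have hb0 : 0 < b := hlo.trans_le hb.1
  have hsplit : a * b = a * α * b + b * β * a := by linear_combination -a * b * hαβ
  have hpos : 0 < a * α + b * β := by
    refine hlo.trans_le ?_
    calc lo = lo * α + lo * β := by rw [← mul_add, hαβ, mul_one]
      _ ≤ a * α + b * β := by gcongr; exacts [ha.1, hb.1]
  rw [mem_Icc, le_div_iff₀ hpos, div_le_iff₀ hpos, hsplit, mul_add, mul_add, mul_comm lo,
    mul_comm lo, mul_comm hi, mul_comm hi]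
  constructor <;> gcongr
  exacts [hb.1, ha.1, hb.2, ha.2]

namespace Mesh

namespace IsAdmissible

variable {T : Mesh d} {Ω : Set (Sp d)} {κ : Sp d → ℝ} {κlo κhi : ℝ}

theorem uniqueDiffOn_closure (hT : T.IsAdmissible Ω) : UniqueDiffOn ℝ (closure Ω) := by
  intro x hx
  rw [← hT.cover] at hx
  obtain ⟨i, hi⟩ := mem_iUnion.1 hx
  refine (uniqueDiffOn_convex (hT.convex_cell i).closure ?_ x hi).mono (hT.closure_cell_subset i)
  exact (hT.nonempty i).mono (interior_maximal subset_closure (hT.isOpen_cell i))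

theorem kbar_mem (hT : T.IsAdmissible Ω) (hκ : ContinuousOn κ (closure Ω))
    (hκb : MapsTo κ (closure Ω) (Icc κlo κhi)) (i : Fin T.N) : T.kbar κ i ∈ Icc κlo κhi := by
  refine (convex_Icc κlo κhi).set_average_mem isClosed_Icc
    ((hT.isOpen_cell i).measure_pos volume (hT.nonempty i)).ne'
    (hT.isBounded_cell i).measure_lt_top.ne ?_ ?_
  · filter_upwards [ae_restrict_mem (hT.isOpen_cell i).measurableSet] with x hx
    exact hκb (hT.closure_cell_subset i (subset_closure hx))
  · exact ((hκ.mono (hT.closure_cell_subset i)).integrableOn_compact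
      (hT.isBounded_cell i).isCompact_closure).mono_set subset_closure

theorem kap_mem (hT : T.IsAdmissible Ω) (hκlo : 0 < κlo) (hκ : ContinuousOn κ (closure Ω))
    (hκb : MapsTo κ (closure Ω) (Icc κlo κhi)) {i j : Fin T.N} (h : T.Adj i j) :
    T.kap κ i j ∈ Icc κlo κhi := by
  refine mul_div_add_mem_Icc hκlo (hT.kbar_mem hκ hκb i) (hT.kbar_mem hκ hκb j)
    (div_nonneg Metric.infDist_nonneg (hT.hh_pos h).le)
    (div_nonneg Metric.infDist_nonneg (hT.hh_pos h).le) ?_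
  rw [← add_div, hT.dist1_add h, div_self (hT.hh_pos h).ne']

theorem integral_source_cell (hΩ : IsPolygonalDomain Ω) (hT : T.IsAdmissible Ω)
    {V f u : Sp d → ℝ} (hκ : ContDiffOn ℝ 1 κ (closure Ω)) (hV : ContDiffOn ℝ 2 V (closure Ω))
    (hu : ContDiffOn ℝ 2 u (closure Ω)) (hsol : SolvesFPE Ω κ V f u) (i : Fin T.N) :
    ∫ x in T.cell i, f x =
      -(∑ j ∈ T.nbrs i, T.flux Ω (fun x => Real.exp (-V x) * κ x)
          (fun x => u x / Real.exp (-V x)) i j +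
        ∑ y ∈ T.bnode i, T.bflux Ω (fun x => Real.exp (-V x) * κ x)
          (fun x => u x / Real.exp (-V x)) i y) := by
  set F : Sp d → Sp d := fun z => (Real.exp (-V z) * κ z) •
    gradientWithin (fun y => u y / Real.exp (-V y)) (closure Ω) z with hF
  have hF_smooth : ContDiffOn ℝ 1 F (closure Ω) :=
    (((hV.of_le one_le_two).neg.exp).mul hκ).smul <| contDiffOn_gradientWithin
      (hu.div hV.neg.exp fun x _ => (Real.exp_pos _).ne') hT.uniqueDiffOn_closure
  obtain ⟨L, hL⟩ := hΩ.exists_lipschitzOnWith hF_smooth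
  have hdiff : DifferentiableOn ℝ F (T.cell i) :=
    (hF_smooth.differentiableOn one_ne_zero).mono
      (subset_closure.trans (hT.closure_cell_subset i))
  have hf : ∫ x in T.cell i, f x = ∫ x in T.cell i, -divergence F x := by
    refine setIntegral_congr_ae (hT.isOpen_cell i).measurableSet ?_
    filter_upwards [(ae_restrict_iff' hΩ.isOpen.measurableSet).1 hsol] with x hx hxi
    have hxΩ := hT.cell_subset hΩ i hxi
    rw [← hx hxΩ, hF, divergence_flux hΩ.isOpen hκ hV hu hxΩ]
    ring
  rw [hf, integral_neg, hT.integral_divergence_cell hΩ i (hL.mono (hT.closure_cell_subset i)) hdiff]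
  simp only [hF, real_inner_smul_left, inner_gradientWithin_left]
  rfl

end IsAdmissible

end Mesh

theorem abs_setIntegral_mul_apply_sub_le {E : Type*} [NormedAddCommGroup E] [NormedSpace ℝ E]
    [MeasurableSpace E] [BorelSpace E] {μ : Measure E} {σ : Set E} (hσ : IsCompact σ)
    (hμσ : μ σ < ⊤) {p κ : E → ℝ} {G : E → E →L[ℝ] ℝ} (hp : ContinuousOn p σ)
    (hκ : ContinuousOn κ σ) (hG : ContinuousOn G σ) {s B k M : ℝ} (hpB : ∀ x ∈ σ, |p x - s| ≤ B)
    (hκk : ∀ x ∈ σ, |κ x| ≤ k) (hGM : ∀ x ∈ σ, ‖G x‖ ≤ M) {ν : E} (hν : ‖ν‖ = 1) :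
    |∫ x in σ, p x * κ x * G x ν ∂μ - s * ∫ x in σ, κ x * G x ν ∂μ| ≤ B * k * M * μ.real σ := by
  have hint : ∀ {f : E → ℝ}, ContinuousOn f σ → IntegrableOn f σ μ := fun hf =>
    hf.integrableOn_of_subset_isCompact hσ hσ.measurableSet Subset.rfl hμσ.ne
  have hGν : ContinuousOn (fun x => G x ν) σ := hG.clm_apply continuousOn_const
  rw [← integral_const_mul, ← integral_sub (hint ((hp.fun_mul hκ).fun_mul hGν))
    ((hint (hκ.fun_mul hGν)).const_mul s), ← Real.norm_eq_abs]
  refine norm_setIntegral_le_of_norm_le_const hμσ fun x hx => ?_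
  have hGx : |G x ν| ≤ M := ((G x).unit_le_opNorm ν hν.le).trans (hGM x hx)
  have hB := (abs_nonneg _).trans (hpB x hx)
  have hk := (abs_nonneg _).trans (hκk x hx)
  calc ‖p x * κ x * G x ν - s * (κ x * G x ν)‖ = |p x - s| * |κ x| * |G x ν| := by
        rw [← abs_mul, ← abs_mul, ← Real.norm_eq_abs]
        ring_nf
    _ ≤ B * k * M := by gcongr; exacts [hpB x hx, hκk x hx]

theorem IsSymmetricMean.abs_apply_sub_le {S : ℝ → ℝ → ℝ} (hS : IsSymmetricMean S) {X : Type*}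
    [PseudoMetricSpace X] {A : Set X} {p : X → ℝ} {L : NNReal} (hp : LipschitzOnWith L p A)
    (hp_pos : ∀ x ∈ A, 0 < p x) {x y z : X} (hx : x ∈ A) (hy : y ∈ A) (hz : z ∈ A) {h : ℝ}
    (hxy : dist x y ≤ h) (hxz : dist x z ≤ h) : |p x - S (p y) (p z)| ≤ L * h :=
  hS.abs_sub_le (hp_pos y hy) (hp_pos z hz)
    ((hp.dist_le_mul x hx y hy).trans (mul_le_mul_of_nonneg_left hxy L.coe_nonneg))
    ((hp.dist_le_mul x hx z hz).trans (mul_le_mul_of_nonneg_left hxz L.coe_nonneg))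

namespace Mesh

variable {T : Mesh d} {Ω : Set (Sp d)} {κ p w : Sp d → ℝ} {S : ℝ → ℝ → ℝ}

theorem flux_comm (T : Mesh d) (Ω : Set (Sp d)) (κ w : Sp d → ℝ) (i j : Fin T.N) :
    T.flux Ω κ w j i = -T.flux Ω κ w i j := by
  simp only [flux, T.face_comm j i, T.hh_comm j i, ← neg_sub (T.node j) (T.node i), smul_neg,
    map_neg, mul_neg, integral_neg]

/-- The residual of the node values of `w` in the scheme on an interior interface: the flux
`∫ p κ ∇w · ν` minus its discretisation, in which the mean `S(p_i, p_j)` replaces `p`. -/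
def residual (T : Mesh d) (Ω : Set (Sp d)) (κ p : Sp d → ℝ) (S : ℝ → ℝ → ℝ) (w : Sp d → ℝ)
    (i j : Fin T.N) : ℝ :=
  T.flux Ω (fun x => p x * κ x) w i j - T.m i j / T.hh i j * T.kap κ i j *
    S (p (T.node i)) (p (T.node j)) * (w (T.node j) - w (T.node i))

/-- The analogue of `residual` on a boundary interface. -/
def bresidual (T : Mesh d) (Ω : Set (Sp d)) (κ p : Sp d → ℝ) (S : ℝ → ℝ → ℝ) (w : Sp d → ℝ)
    (i : Fin T.N) (y : Sp d) : ℝ :=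
  T.bflux Ω (fun x => p x * κ x) w i y - T.bm Ω i y / T.bh i y * T.kbar κ i *
    S (p (T.node i)) (p y) * (w y - w (T.node i))

theorem sum_eq_sum_residual {f : Sp d → ℝ} {v : Fin T.N → ℝ} (hv : T.SolvesScheme Ω κ p f S v)
    {i : Fin T.N}
    (hsource : ∫ x in T.cell i, f x = -(∑ j ∈ T.nbrs i, T.flux Ω (fun x => p x * κ x) w i j +
      ∑ y ∈ T.bnode i, T.bflux Ω (fun x => p x * κ x) w i y))
    (hw : ∀ y ∈ T.bnode i, w y = 0) {e : Fin T.N → ℝ}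
    (he : ∀ i, e i = v i / p (T.node i) - w (T.node i)) :
    ∑ j ∈ T.nbrs i,
        T.m i j / T.hh i j * T.kap κ i j * S (p (T.node i)) (p (T.node j)) * (e j - e i) +
      ∑ y ∈ T.bnode i, T.bm Ω i y / T.bh i y * T.kbar κ i * S (p (T.node i)) (p y) * (0 - e i) =
      ∑ j ∈ T.nbrs i, T.residual Ω κ p S w i j + ∑ y ∈ T.bnode i, T.bresidual Ω κ p S w i y := by
  have hbalance := hv i
  rw [hsource, neg_inj] at hbalance
  simp only [residual, bresidual, Finset.sum_sub_distrib]
  rw [← add_sub_add_comm, ← hbalance, add_sub_add_comm, ← Finset.sum_sub_distrib,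
    ← Finset.sum_sub_distrib]
  congr 1
  · refine Finset.sum_congr rfl fun j _ => ?_
    rw [he, he]
    ring
  · refine Finset.sum_congr rfl fun y hy => ?_
    rw [he, hw y hy]
    ring

theorem sq_div_le {m h k s c r k₁ p₁ p₂ G : ℝ} (hm : 0 < m) (hh : 0 < h) (hk₁ : 0 < k₁)
    (hk : k₁ ≤ k) (hp₁ : 0 < p₁) (hs : s ∈ Icc p₁ p₂) (hr : |r - s * c| ≤ G * m) :
    r ^ 2 / (m / h * k * s) ≤
      2 * p₂ * (h / m * k⁻¹ * |c| ^ 2) + 2 * (G ^ 2 / (k₁ * p₁)) * (m * h) := by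
  have hk0 : 0 < k := hk₁.trans_le hk
  have hs0 : 0 < s := hp₁.trans_le hs.1
  have hsq : r ^ 2 ≤ 2 * (s * c) ^ 2 + 2 * (G * m) ^ 2 := by
    have hsplit : r ^ 2 ≤ 2 * ((s * c) ^ 2 + (r - s * c) ^ 2) := by
      simpa using add_sq_le (a := s * c) (b := r - s * c)
    linarith [sq_le_sq' (abs_le.1 hr).1 (abs_le.1 hr).2]
  calc r ^ 2 / (m / h * k * s)
      ≤ (2 * (s * c) ^ 2 + 2 * (G * m) ^ 2) / (m / h * k * s) := by gcongr
    _ = 2 * s * (h / m * k⁻¹ * |c| ^ 2) + 2 * (G ^ 2 / (k * s)) * (m * h) := by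
        rw [sq_abs]
        field_simp
    _ ≤ 2 * p₂ * (h / m * k⁻¹ * |c| ^ 2) + 2 * (G ^ 2 / (k₁ * p₁)) * (m * h) := by
        gcongr
        exacts [hs.2, hs.1]

namespace IsAdmissible

theorem dist_le_diam_cell (hT : T.IsAdmissible Ω) {i : Fin T.N} {x y : Sp d}
    (hx : x ∈ closure (T.cell i)) (hy : y ∈ closure (T.cell i)) :
    dist x y ≤ Metric.diam (T.cell i) := by
  rw [← Metric.diam_closure]
  exact Metric.dist_le_diam_of_mem (hT.isBounded_cell i).closure hx hy

theorem bnode_mem_closure_cell (hT : T.IsAdmissible Ω) {i : Fin T.N} {y : Sp d}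
    (hy : y ∈ T.bnode i) : y ∈ closure (T.cell i) :=
  T.bface_subset_closure Ω i y (hT.bnode_mem i y hy)

theorem residual_comm (hT : T.IsAdmissible Ω) (hS : IsSymmetricMean S)
    (hp_pos : ∀ x ∈ closure Ω, 0 < p x) (i j : Fin T.N) :
    T.residual Ω κ p S w j i = -T.residual Ω κ p S w i j := by
  rw [residual, residual, flux_comm, T.m_comm j i, T.hh_comm j i, T.kap_comm κ j i,
    hS.symm (hp_pos _ (hT.node_mem_closure j)) (hp_pos _ (hT.node_mem_closure i))]
  ring

section Freezing

variable {k M h : ℝ} {L : NNReal} (hT : T.IsAdmissible Ω) (hS : IsSymmetricMean S)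
  (hκ : ContinuousOn κ (closure Ω)) (hκk : ∀ x ∈ closure Ω, |κ x| ≤ k)
  (hp : LipschitzOnWith L p (closure Ω)) (hp_pos : ∀ x ∈ closure Ω, 0 < p x)
  (hw : ContinuousOn (fderivWithin ℝ w (closure Ω)) (closure Ω))
  (hwM : ∀ x ∈ closure Ω, ‖fderivWithin ℝ w (closure Ω) x‖ ≤ M)
  (hdiam : ∀ i, Metric.diam (T.cell i) ≤ h)

include hT hS hκ hκk hp hp_pos hw hwM hdiam

theorem abs_residual_sub_le {i j : Fin T.N} (hij : T.Adj i j) :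
    |T.residual Ω κ p S w i j - S (p (T.node i)) (p (T.node j)) * (T.flux Ω κ w i j -
        T.kap κ i j * (T.m i j / T.hh i j) * (w (T.node j) - w (T.node i)))| ≤
      L * h * k * M * T.m i j := by
  have hsub : T.face i j ⊆ closure Ω :=
    (T.face_subset_closure i j).trans (hT.closure_cell_subset i)
  have hclose : ∀ x ∈ T.face i j, |p x - S (p (T.node i)) (p (T.node j))| ≤ L * h := fun x hx =>
    have hxij := T.face_subset_closure_inter i j hx
    hS.abs_apply_sub_le hp hp_pos (hsub hx) (hT.node_mem_closure i) (hT.node_mem_closure j)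
      ((hT.dist_le_diam_cell hxij.1 (hT.node_mem i)).trans (hdiam i))
      ((hT.dist_le_diam_cell hxij.2 (hT.node_mem j)).trans (hdiam j))
  refine (congrArg abs ?_).trans_le <| abs_setIntegral_mul_apply_sub_le (hT.isCompact_face i j)
    (hT.surf_face_lt_top hij) (hp.continuousOn.mono hsub) (hκ.mono hsub) (hw.mono hsub) hclose
    (fun x hx => hκk x (hsub hx)) (fun x hx => hwM x (hsub hx)) (norm_direction (hT.node_ne hij))
  simp only [residual, flux, direction, hh]
  ring

theorem abs_bresidual_sub_le {i : Fin T.N} {y : Sp d} (hy : y ∈ T.bnode i) :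
    |T.bresidual Ω κ p S w i y - S (p (T.node i)) (p y) * (T.bflux Ω κ w i y -
        T.kbar κ i * (T.bm Ω i y / T.bh i y) * (w y - w (T.node i)))| ≤
      L * h * k * M * T.bm Ω i y := by
  have hsub : T.bface Ω i y ⊆ closure Ω :=
    (T.bface_subset_closure Ω i y).trans (hT.closure_cell_subset i)
  have hclose : ∀ x ∈ T.bface Ω i y, |p x - S (p (T.node i)) (p y)| ≤ L * h := fun x hx =>
    have hxi := T.bface_subset_closure Ω i y hx
    hS.abs_apply_sub_le hp hp_pos (hsub hx) (hT.node_mem_closure i)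
      (hT.closure_cell_subset i (hT.bnode_mem_closure_cell hy))
      ((hT.dist_le_diam_cell hxi (hT.node_mem i)).trans (hdiam i))
      ((hT.dist_le_diam_cell hxi (hT.bnode_mem_closure_cell hy)).trans (hdiam i))
  refine (congrArg abs ?_).trans_le <| abs_setIntegral_mul_apply_sub_le (hT.isCompact_bface i y)
    (hT.surf_bface_lt_top hy) (hp.continuousOn.mono hsub) (hκ.mono hsub) (hw.mono hsub) hclose
    (fun x hx => hκk x (hsub hx)) (fun x hx => hwM x (hsub hx))
    (norm_direction (hT.node_ne_of_mem_bnode hy))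
  simp only [bresidual, bflux, direction, bh]
  ring

end Freezing

end IsAdmissible

end Mesh

theorem sq_mul_sub_mul_le {P R a b x y : ℝ} (hb : |b| ≤ P) (hba : |b - a| ≤ R) :
    (b * y - a * x) ^ 2 ≤ 2 * P ^ 2 * (y - x) ^ 2 + 2 * R ^ 2 * x ^ 2 := by
  have hsplit : (b * y - a * x) ^ 2 ≤ 2 * ((b * (y - x)) ^ 2 + ((b - a) * x) ^ 2) := by
    refine (congrArg (· ^ 2) ?_).trans_le add_sq_le
    ring
  have hP : b ^ 2 ≤ P ^ 2 := sq_le_sq' (abs_le.1 hb).1 (abs_le.1 hb).2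
  have hR : (b - a) ^ 2 ≤ R ^ 2 := sq_le_sq' (abs_le.1 hba).1 (abs_le.1 hba).2
  calc (b * y - a * x) ^ 2 ≤ 2 * (b ^ 2 * (y - x) ^ 2 + (b - a) ^ 2 * x ^ 2) := by
        rwa [← mul_pow, ← mul_pow]
    _ ≤ 2 * (P ^ 2 * (y - x) ^ 2 + R ^ 2 * x ^ 2) := by gcongr
    _ = 2 * P ^ 2 * (y - x) ^ 2 + 2 * R ^ 2 * x ^ 2 := by ring

theorem div_mul_mul_sq_le {m h k K P L a b x y z : ℝ} (hm : 0 < m) (hh : 0 < h) (hK : 0 ≤ K)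
    (hk : k ≤ K) (hb : |b| ≤ P) (hba : |b - a| ≤ L * h) (hz : x ^ 2 ≤ z) :
    m / h * k * (b * y - a * x) ^ 2 ≤
      K * (2 * P ^ 2 * (m / h * (y - x) ^ 2) + 2 * L ^ 2 * (m * h * z)) := by
  calc m / h * k * (b * y - a * x) ^ 2
      ≤ m / h * K * (2 * P ^ 2 * (y - x) ^ 2 + 2 * (L * h) ^ 2 * z) := by
        gcongr
        exact (sq_mul_sub_mul_le hb hba).trans (by gcongr)
    _ = K * (2 * P ^ 2 * (m / h * (y - x) ^ 2) + 2 * L ^ 2 * (m * h * z)) := by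
        field_simp

namespace Mesh

namespace IsAdmissible

variable {T : Mesh d} {Ω : Set (Sp d)} {κ p w f : Sp d → ℝ} {S : ℝ → ℝ → ℝ}
  {κlo κhi p₁ p₂ M h : ℝ} {L : NNReal}

theorem mean_mem_Icc (hT : T.IsAdmissible Ω) (hS : IsSymmetricMean S) (hp₁ : 0 < p₁)
    (hpb : MapsTo p (closure Ω) (Icc p₁ p₂)) (i j : Fin T.N) :
    S (p (T.node i)) (p (T.node j)) ∈ Icc p₁ p₂ :=
  hS.mem_Icc hp₁ (hpb (hT.node_mem_closure i)) (hpb (hT.node_mem_closure j))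

theorem bmean_mem_Icc (hT : T.IsAdmissible Ω) (hS : IsSymmetricMean S) (hp₁ : 0 < p₁)
    (hpb : MapsTo p (closure Ω) (Icc p₁ p₂)) {i : Fin T.N} {y : Sp d} (hy : y ∈ T.bnode i) :
    S (p (T.node i)) (p y) ∈ Icc p₁ p₂ :=
  hS.mem_Icc hp₁ (hpb (hT.node_mem_closure i))
    (hpb (hT.closure_cell_subset i (hT.bnode_mem_closure_cell hy)))

theorem mul_seminormSq_le_edgeSum_residual (hT : T.IsAdmissible Ω) (hS : IsSymmetricMean S)
    (hκlo : 0 < κlo) (hκ : ContinuousOn κ (closure Ω))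
    (hκb : MapsTo κ (closure Ω) (Icc κlo κhi)) (hp₁ : 0 < p₁)
    (hpb : MapsTo p (closure Ω) (Icc p₁ p₂)) (hw₀ : ∀ x ∈ frontier Ω, w x = 0)
    {v : Fin T.N → ℝ} (hv : T.SolvesScheme Ω κ p f S v)
    (hsource : ∀ i, ∫ x in T.cell i, f x =
      -(∑ j ∈ T.nbrs i, T.flux Ω (fun x => p x * κ x) w i j +
        ∑ y ∈ T.bnode i, T.bflux Ω (fun x => p x * κ x) w i y)) :
    κlo * p₁ * T.seminormSq Ω (fun i => v i / p (T.node i) - w (T.node i)) ≤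
      T.edgeSum
        (fun i j => T.residual Ω κ p S w i j ^ 2 /
          (T.m i j / T.hh i j * T.kap κ i j * S (p (T.node i)) (p (T.node j))))
        (fun i y => T.bresidual Ω κ p S w i y ^ 2 /
          (T.bm Ω i y / T.bh i y * T.kbar κ i * S (p (T.node i)) (p y))) := by
  have hp_pos : ∀ x ∈ closure Ω, 0 < p x := fun x hx => hp₁.trans_le (hpb hx).1
  have hcoercive : ∀ {m h k s δ : ℝ}, 0 < m → 0 < h → κlo ≤ k → p₁ ≤ s →
      κlo * p₁ * (m / h * δ ^ 2) ≤ m / h * k * s * δ ^ 2 := by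
    intro m h k s δ hm hh hk hs
    have hk0 := hκlo.le.trans hk
    calc κlo * p₁ * (m / h * δ ^ 2) ≤ k * s * (m / h * δ ^ 2) := by gcongr
      _ = m / h * k * s * δ ^ 2 := by ring
  rw [seminormSq, ← edgeSum_const_mul]
  refine (edgeSum_mono
    (fun i j hij => hcoercive (hT.m_pos hij) (hT.hh_pos hij) (hT.kap_mem hκlo hκ hκb hij).1
      (hT.mean_mem_Icc hS hp₁ hpb i j).1)
    fun i y hy => hcoercive (hT.bm_pos hy) (hT.bh_pos hy) (hT.kbar_mem hκ hκb i).1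
      (hT.bmean_mem_Icc hS hp₁ hpb hy).1).trans <|
    edgeSum_mul_sq_le (fun i j _ => ?_) (fun i j _ => hT.residual_comm hS hp_pos i j)
      (fun i => sum_eq_sum_residual hv (hsource i)
        (fun y hy => hw₀ y (hT.bnode_mem i y hy).1.2) fun _ => rfl)
      (fun i j hij => ?_) fun i y hy => ?_
  · rw [T.m_comm j i, T.hh_comm j i, T.kap_comm κ j i,
      hS.symm (hp_pos _ (hT.node_mem_closure j)) (hp_pos _ (hT.node_mem_closure i))]
  · exact mul_pos (mul_pos (div_pos (hT.m_pos hij) (hT.hh_pos hij))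
      (hκlo.trans_le (hT.kap_mem hκlo hκ hκb hij).1))
      (hp₁.trans_le (hT.mean_mem_Icc hS hp₁ hpb i j).1)
  · exact mul_pos (mul_pos (div_pos (hT.bm_pos hy) (hT.bh_pos hy))
      (hκlo.trans_le (hT.kbar_mem hκ hκb i).1)) (hp₁.trans_le (hT.bmean_mem_Icc hS hp₁ hpb hy).1)

theorem edgeSum_residual_sq_div_le (hΩ : IsPolygonalDomain Ω) (hT : T.IsAdmissible Ω)
    (hS : IsSymmetricMean S) (hκlo : 0 < κlo) (hκ : ContinuousOn κ (closure Ω))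
    (hκb : MapsTo κ (closure Ω) (Icc κlo κhi)) (hp₁ : 0 < p₁)
    (hpb : MapsTo p (closure Ω) (Icc p₁ p₂)) (hp : LipschitzOnWith L p (closure Ω))
    (hw : ContinuousOn (fderivWithin ℝ w (closure Ω)) (closure Ω))
    (hwM : ∀ x ∈ closure Ω, ‖fderivWithin ℝ w (closure Ω) x‖ ≤ M)
    (hdiam : ∀ i, Metric.diam (T.cell i) ≤ h) :
    T.edgeSum
        (fun i j => T.residual Ω κ p S w i j ^ 2 /
          (T.m i j / T.hh i j * T.kap κ i j * S (p (T.node i)) (p (T.node j))))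
        (fun i y => T.bresidual Ω κ p S w i y ^ 2 /
          (T.bm Ω i y / T.bh i y * T.kbar κ i * S (p (T.node i)) (p y))) ≤
      2 * p₂ * T.consistencyError Ω κ w +
        2 * ((L * h * κhi * M) ^ 2 / (κlo * p₁)) * (d * volume.real Ω) := by
  have hp_pos : ∀ x ∈ closure Ω, 0 < p x := fun x hx => hp₁.trans_le (hpb hx).1
  have hκhi : ∀ x ∈ closure Ω, |κ x| ≤ κhi := fun x hx => by
    rw [abs_of_pos (hκlo.trans_le (hκb hx).1)]
    exact (hκb hx).2
  refine (edgeSum_mono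
    (fun i j hij => sq_div_le (hT.m_pos hij) (hT.hh_pos hij) hκlo
      (hT.kap_mem hκlo hκ hκb hij).1 hp₁ (hT.mean_mem_Icc hS hp₁ hpb i j)
      (hT.abs_residual_sub_le hS hκ hκhi hp hp_pos hw hwM hdiam hij))
    fun i y hy => sq_div_le (hT.bm_pos hy) (hT.bh_pos hy) hκlo (hT.kbar_mem hκ hκb i).1 hp₁
      (hT.bmean_mem_Icc hS hp₁ hpb hy)
      (hT.abs_bresidual_sub_le hS hκ hκhi hp hp_pos hw hwM hdiam hy)).trans ?_
  rw [edgeSum_add, edgeSum_const_mul, edgeSum_const_mul, consistencyError]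
  gcongr
  exact hT.edgeSum_m_mul_hh_le hΩ

theorem normSq_mul_le (hΩ : IsPolygonalDomain Ω) (hT : T.IsAdmissible Ω) (hκlo : 0 < κlo)
    (hκ : ContinuousOn κ (closure Ω)) (hκb : MapsTo κ (closure Ω) (Icc κlo κhi))
    (hpb : ∀ x ∈ closure Ω, |p x| ≤ p₂) (hp : LipschitzOnWith L p (closure Ω))
    (e : Fin T.N → ℝ) :
    T.normSq Ω κ (fun i => p (T.node i) * e i) ≤
      κhi * (2 * p₂ ^ 2 + 44 * L ^ 2 * Metric.diam Ω ^ 2) * T.seminormSq Ω e := by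
  have hlip : ∀ {x y : Sp d}, x ∈ closure Ω → y ∈ closure Ω → |p y - p x| ≤ L * dist x y :=
    fun hx hy => by
      rw [dist_comm]
      exact hp.dist_le_mul _ hy _ hx
  have hle : T.normSq Ω κ (fun i => p (T.node i) * e i) ≤
      κhi * (2 * p₂ ^ 2 * T.seminormSq Ω e + 2 * L ^ 2 * T.edgeMassSq Ω e) := by
    rw [normSq, seminormSq, edgeMassSq, ← edgeSum_const_mul, ← edgeSum_const_mul, ← edgeSum_add,
      ← edgeSum_const_mul]
    refine edgeSum_mono (fun i j hij => ?_) fun i y hy => ?_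
    · have hk := hT.kap_mem hκlo hκ hκb hij
      exact div_mul_mul_sq_le (hT.m_pos hij) (hT.hh_pos hij) (hκlo.le.trans (hk.1.trans hk.2)) hk.2
        (hpb _ (hT.node_mem_closure j)) (hlip (hT.node_mem_closure i) (hT.node_mem_closure j))
        (le_add_of_nonneg_right (sq_nonneg _))
    · have hk := hT.kbar_mem hκ hκb i
      have hyΩ := hT.closure_cell_subset i (hT.bnode_mem_closure_cell hy)
      simpa only [mul_zero] using div_mul_mul_sq_le (y := 0) (hT.bm_pos hy) (hT.bh_pos hy)
        (hκlo.le.trans (hk.1.trans hk.2)) hk.2 (hpb y hyΩ) (hlip (hT.node_mem_closure i) hyΩ) le_rfl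
  obtain ⟨x, hx⟩ := hΩ.isConnected.nonempty
  have hκx := hκb (subset_closure hx)
  have hκhi : 0 ≤ κhi := hκlo.le.trans (hκx.1.trans hκx.2)
  calc T.normSq Ω κ (fun i => p (T.node i) * e i)
      ≤ κhi * (2 * p₂ ^ 2 * T.seminormSq Ω e + 2 * L ^ 2 * T.edgeMassSq Ω e) := hle
    _ ≤ κhi * (2 * p₂ ^ 2 * T.seminormSq Ω e +
          2 * L ^ 2 * (22 * Metric.diam Ω ^ 2 * T.seminormSq Ω e)) := by
        gcongr
        exact hT.edgeMassSq_le_seminormSq hΩ e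
    _ = κhi * (2 * p₂ ^ 2 + 44 * L ^ 2 * Metric.diam Ω ^ 2) * T.seminormSq Ω e := by ring

end IsAdmissible

end Mesh

theorem exists_mapsTo_Icc_of_pos {X : Type*} [TopologicalSpace X] {A : Set X} (hA : IsCompact A)
    {p : X → ℝ} (hp : ContinuousOn p A) (hp_pos : ∀ x ∈ A, 0 < p x) :
    ∃ p₁ p₂ : ℝ, 0 < p₁ ∧ MapsTo p A (Icc p₁ p₂) := by
  obtain ⟨p₁, hp₁, hlower⟩ := hA.exists_forall_le' hp hp_pos
  obtain ⟨p₂, hupper⟩ := hA.bddAbove_image hp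
  exact ⟨p₁, p₂, hp₁, fun x hx => ⟨hlower x hx, hupper (mem_image_of_mem p hx)⟩⟩

theorem mapsTo_closure_Icc {X : Type*} [TopologicalSpace X] {A : Set X} {κ : X → ℝ} {lo hi : ℝ}
    (hκ : ContinuousOn κ (closure A)) (hκb : MapsTo κ A (Icc lo hi)) :
    MapsTo κ (closure A) (Icc lo hi) := by
  simpa only [isClosed_Icc.closure_eq] using hκb.closure_of_continuousOn hκ

theorem mul_add_mul_sq_le {a b E K ε h : ℝ} (ha : 0 ≤ a) (hb : 0 ≤ b) (hE : E ≤ K * ε ^ 2) :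
    a * E + b * h ^ 2 ≤ (a * |K| + b) * (ε ^ 2 + h ^ 2) := by
  calc a * E + b * h ^ 2 ≤ a * (|K| * (ε ^ 2 + h ^ 2)) + b * (ε ^ 2 + h ^ 2) := by
        gcongr
        · exact hE.trans (mul_le_mul (le_abs_self K) (le_add_of_nonneg_right (sq_nonneg h))
            (sq_nonneg ε) (abs_nonneg K))
        · exact le_add_of_nonneg_left (sq_nonneg ε)
    _ = (a * |K| + b) * (ε ^ 2 + h ^ 2) := by ring

theorem C2NormLE.norm_fderivWithin_le {Ω : Set (Sp d)} {w : Sp d → ℝ} {M : ℝ}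
    (hw : C2NormLE Ω w M) (hΩ : UniqueDiffOn ℝ (closure Ω)) {x : Sp d} (hx : x ∈ closure Ω) :
    ‖fderivWithin ℝ w (closure Ω) x‖ ≤ M := by
  rw [← norm_iteratedFDerivWithin_one _ (hΩ x hx)]
  exact hw 1 one_le_two x hx

namespace Mesh

namespace IsAdmissible

variable {T : Mesh d} {Ω : Set (Sp d)} {κ p w f : Sp d → ℝ} {S : ℝ → ℝ → ℝ}
  {κlo κhi p₁ p₂ M h : ℝ} {L : NNReal}

theorem normSq_sub_le (hΩ : IsPolygonalDomain Ω) (hT : T.IsAdmissible Ω)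
    (hS : IsSymmetricMean S) (hκlo : 0 < κlo) (hκ : ContinuousOn κ (closure Ω))
    (hκb : MapsTo κ (closure Ω) (Icc κlo κhi)) (hp₁ : 0 < p₁)
    (hpb : MapsTo p (closure Ω) (Icc p₁ p₂)) (hp : LipschitzOnWith L p (closure Ω))
    (hw₀ : ∀ x ∈ frontier Ω, w x = 0)
    (hw : ContinuousOn (fderivWithin ℝ w (closure Ω)) (closure Ω))
    (hwM : ∀ x ∈ closure Ω, ‖fderivWithin ℝ w (closure Ω) x‖ ≤ M)
    (hdiam : ∀ i, Metric.diam (T.cell i) ≤ h) {v : Fin T.N → ℝ}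
    (hv : T.SolvesScheme Ω κ p f S v)
    (hsource : ∀ i, ∫ x in T.cell i, f x =
      -(∑ j ∈ T.nbrs i, T.flux Ω (fun x => p x * κ x) w i j +
        ∑ y ∈ T.bnode i, T.bflux Ω (fun x => p x * κ x) w i y)) :
    T.normSq Ω κ (fun i => v i - p (T.node i) * w (T.node i)) ≤
      κhi * (2 * p₂ ^ 2 + 44 * L ^ 2 * Metric.diam Ω ^ 2) *
        ((2 * p₂ * T.consistencyError Ω κ w +
          2 * ((L * κhi * M) ^ 2 / (κlo * p₁)) * (d * volume.real Ω) * h ^ 2) / (κlo * p₁)) := by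
  have henergy := (hT.mul_seminormSq_le_edgeSum_residual hS hκlo hκ hκb hp₁ hpb hw₀ hv
    hsource).trans (hT.edgeSum_residual_sq_div_le hΩ hS hκlo hκ hκb hp₁ hpb hp hw hwM hdiam)
  rw [← le_div_iff₀' (mul_pos hκlo hp₁), show 2 * ((L * h * κhi * M) ^ 2 / (κlo * p₁)) *
    (d * volume.real Ω) = 2 * ((L * κhi * M) ^ 2 / (κlo * p₁)) * (d * volume.real Ω) * h ^ 2 by
      ring] at henergy
  have hpos : ∀ x ∈ closure Ω, 0 < p x := fun x hx => hp₁.trans_le (hpb hx).1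
  have hnorm := hT.normSq_mul_le hΩ hκlo hκ hκb
    (fun x hx => (abs_of_pos (hpos x hx)).trans_le (hpb hx).2) hp
    fun i => v i / p (T.node i) - w (T.node i)
  obtain ⟨x, hx⟩ := hΩ.isConnected.nonempty
  have hκx := hκb (subset_closure hx)
  have hκhi : 0 ≤ κhi := hκlo.le.trans (hκx.1.trans hκx.2)
  simp only [mul_sub, mul_div_cancel₀ _ (hpos _ (hT.node_mem_closure _)).ne'] at hnorm
  exact hnorm.trans (by gcongr)

end IsAdmissible

end Mesh

end StolarskyFV

end

open StolarskyFV Set in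
theorem mainTheorem1_general {d : ℕ} {Ω : Set (Sp d)} (hΩ : IsPolygonalDomain Ω) {κlo : ℝ}
    (hκlo : 0 < κlo) (κhi : ℝ) {V : Sp d → ℝ} (hV : ContDiffOn ℝ 2 V (closure Ω)) (M K : ℝ) :
    ∃ C : ℝ, 0 ≤ C ∧
      ∀ κ : Sp d → ℝ, ContDiffOn ℝ 1 κ (closure Ω) → MapsTo κ Ω (Icc κlo κhi) →
      ∀ S : ℝ → ℝ → ℝ, IsSymmetricMean S →
      ∀ T : Mesh d, T.IsAdmissible Ω → ∀ h, (∀ i, Metric.diam (T.cell i) ≤ h) →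
      ∀ u ∈ C20 Ω, ∀ f, SolvesFPE Ω κ V f u →
        (∀ x ∈ closure Ω,
          ‖fderivWithin ℝ (fun x => u x / Real.exp (-V x)) (closure Ω) x‖ ≤ M) →
      ∀ ε, T.consistencyError Ω κ (fun x => u x / Real.exp (-V x)) ≤ K * ε ^ 2 →
      ∀ v, T.SolvesScheme Ω κ (fun x => Real.exp (-V x)) f S v →
        T.normSq Ω κ (fun i => v i - u (T.node i)) ≤ C * (ε ^ 2 + h ^ 2) := by
  set p : Sp d → ℝ := fun x => Real.exp (-V x) with hp_def
  have hp : ContDiffOn ℝ 1 p (closure Ω) := (hV.of_le one_le_two).neg.exp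
  obtain ⟨L, hL⟩ := hΩ.exists_lipschitzOnWith hp
  obtain ⟨p₁, p₂, hp₁, hpb⟩ := exists_mapsTo_Icc_of_pos hΩ.isCompact_closure hp.continuousOn
    fun x _ => Real.exp_pos (-V x)
  obtain ⟨x₀, hx₀⟩ := hΩ.isConnected.nonempty
  have hp₂ : 0 < p₂ := (Real.exp_pos _).trans_le (hpb (subset_closure hx₀)).2
  let A := 2 * p₂ ^ 2 + 44 * L ^ 2 * Metric.diam Ω ^ 2
  let Q := 2 * ((L * κhi * M) ^ 2 / (κlo * p₁)) * (d * volume.real Ω)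
  refine ⟨|κhi| * A * ((2 * p₂ * |K| + Q) / (κlo * p₁)), by positivity, ?_⟩
  intro κ hκ hκb S hS T hT h hdiam u hu f hsol hM ε hcons v hv
  have hκhi : 0 < κhi := hκlo.trans_le ((hκb hx₀).1.trans (hκb hx₀).2)
  have hU : ContDiffOn ℝ 2 (fun x => u x / p x) (closure Ω) :=
    hu.1.div hV.neg.exp fun x _ => (Real.exp_pos _).ne'
  have herror := hT.normSq_sub_le hΩ hS hκlo hκ.continuousOn
    (mapsTo_closure_Icc hκ.continuousOn hκb) hp₁ hpb hL
    (fun x hx => by rw [hu.2 x hx, zero_div])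
    (hU.continuousOn_fderivWithin hT.uniqueDiffOn_closure (by norm_num)) hM hdiam hv
    (hT.integral_source_cell hΩ hκ hV hu.1 hsol)
  simp only [mul_div_cancel₀ _ (Real.exp_pos _).ne', hp_def] at herror
  calc T.normSq Ω κ (fun i => v i - u (T.node i))
      ≤ κhi * A * ((2 * p₂ * |K| + Q) * (ε ^ 2 + h ^ 2) / (κlo * p₁)) := by
        refine herror.trans ?_
        gcongr
        exact mul_add_mul_sq_le (by positivity) (by positivity) hcons
    _ = |κhi| * A * ((2 * p₂ * |K| + Q) / (κlo * p₁)) * (ε ^ 2 + h ^ 2) := by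
        rw [abs_of_pos hκhi]
        ring

open StolarskyFV in
theorem mainTheorem1 {d : ℕ} (hd : 0 < d) (Ω : Set (Sp d)) (hΩ : IsPolygonalDomain Ω)
    (κlo κhi : ℝ) (hκlo : 0 < κlo)
    (V : Sp d → ℝ) (hV : ContDiffOn ℝ 2 V (closure Ω))
    (M K : ℝ) :
    ∃ C : ℝ, 0 ≤ C ∧
      ∀ (κ : Sp d → ℝ), ContDiffOn ℝ 1 κ (closure Ω) → (∀ x ∈ Ω, κlo ≤ κ x ∧ κ x ≤ κhi) →
      ∀ (S : ℝ → ℝ → ℝ), IsSmoothMean S →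
      ∀ (H : Set ℝ), (∀ h ∈ H, 0 < h) →
      ∀ (T : ℝ → Mesh d), (∀ h ∈ H, (T h).IsAdmissible Ω) →
        (∀ h ∈ H, ∀ i, Metric.diam ((T h).cell i) ≤ h) →
      ∀ (φ : ℝ → ℝ), (∀ t, 0 ≤ t → 0 ≤ φ t) →
      ∀ (B : Set (Sp d → ℝ)) (c : (Sp d → ℝ) → ℝ), B ⊆ C20 Ω →
        IsPhiConsistent Ω κ H T φ B c →
      ∀ (u f : Sp d → ℝ), u ∈ C20 Ω → SolvesFPE Ω κ V f u →
        (fun x => u x / Real.exp (-V x)) ∈ B →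
        C2NormLE Ω (fun x => u x / Real.exp (-V x)) M →
        c (fun x => u x / Real.exp (-V x)) ≤ K →
      ∀ (uT : ∀ h : ℝ, Fin (T h).N → ℝ),
        (∀ h ∈ H, (T h).SolvesScheme Ω κ (fun x => Real.exp (-V x)) f S (uT h)) →
      ∀ h ∈ H,
        (T h).normSq Ω κ (fun i => uT h i - u ((T h).node i)) ≤ C * (φ h ^ 2 + h ^ 2) := by
  obtain ⟨C, hC, hbound⟩ := mainTheorem1_general hΩ hκlo κhi hV M K
  refine ⟨C, hC, ?_⟩
  intro κ hκ hκb S hS H _ T hT hdiam φ _ B c _ hcons u f hu hsol hUB hM hcK uT huT h hh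
  exact hbound κ hκ hκb S hS.isSymmetricMean (T h) (hT h hh) h (hdiam h hh) u hu f hsol
    (fun x => hM.norm_fderivWithin_le (hT h hh).uniqueDiffOn_closure) (φ h)
    (((hcons _ hUB).2 h hh).trans (by gcongr)) (uT h) (huT h hh)
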